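/- Let $I=[-1,1]$. For integers $d,m\ge 1$ let $W_m^d$ be the set of functions $h$ on $I^d$ with continuous partial derivatives of all orders up to $m$ on $I^d$ such that $\|h\|+\sum_{1\le |k|\le m}\|D^k h\|\le 1$, where $\|\cdot\|$ is the sup norm on $I^d$ and $k$ runs over multi-indices. For $\sigma:\mathbb R\to\mathbb R$ let $\mathcal S_{M,2}$ be the set of shallow networks $y\mapsto\sum_{k=1}^M a_k\,\sigma(\langle w_k,y\rangle+b_k)$ on $\mathbb R^2$, with $w_k\in\mathbb R^2$ and $a_k,b_k\in\mathbb R$. Let $T$ be a binary tree in which every non-leaf vertex has exactly two ordered children and whose $n$ leaves are labelled by the variables $x_1,\dots,x_n$, each occurring exactly once; let $V$ be its set of non-leaf vertices, so $|V|=n-1$. If a function of two variables is attached to each vertex in $V$, the tree computes a function of $(x_1,\dots,x_n)$: each leaf outputs its variable, each non-leaf vertex applies its function to the outputs of its two children, and the value at the root is the result. Let $W_m^{n,2}(T)$ be the class of functions on $I^n$ computed in this way with all constituent functions in $W_m^2$ (which map $I^2$ into $I$), and let $\mathcal D_{N,2}(T)$ be the class of deep networks computed in this way with all constituent functions in $\mathcal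 S_{M,2}$, where $N=|V|\,M$ is the total number of units. Theorem. Let $m\ge 1$ and let $\sigma:\mathbb R\to\mathbb R$ be infinitely differentiable and not a polynomial. There is a constant $C>0$, depending only on $m$ and $\sigma$, such that for every $n$, every such tree $T$ with $n$ leaves and every $\varepsilon>0$ there is an $$N\le C\,(n-1)\,\varepsilon^{-2/m}$$ such that for every $f\in W_m^{n,2}(T)$ there is a deep network $P\in\mathcal D_{N,2}(T)$ with the same tree and activation $\sigma$ for which $\sup_{x\in I^n}|f(x)-P(x)|\le\varepsilon$. -/

import Mathlib

open scoped ContDiff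

noncomputable section

namespace DeepNet

/-- The cube `I^d = [-1,1]^d`. -/
def cube (d : ℕ) : Set (Fin d → ℝ) := {x | ∀ i, x i ∈ Set.Icc (-1 : ℝ) 1}

/-- The sup norm of a function on the cube (finite and attained for continuous functions). -/
def supNorm {d : ℕ} (g : (Fin d → ℝ) → ℝ) : ℝ := ⨆ x : cube d, |g x|

/-- The partial derivative in the `i`-th coordinate of a function on the cube
(one-sided at the faces `x i = ± 1`). -/
def partialDeriv {d : ℕ} (i : Fin d) (g : (Fin d → ℝ) → ℝ) : (Fin d → ℝ) → ℝ :=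
  fun x => derivWithin (fun s => g (Function.update x i s)) (Set.Icc (-1 : ℝ) 1) (x i)

/-- The partial derivative `D^k g` for a multi-index `k`: differentiate `k i` times in the
coordinate `i`, for every `i`. -/
def multiDeriv {d : ℕ} (k : Fin d → ℕ) (g : (Fin d → ℝ) → ℝ) : (Fin d → ℝ) → ℝ :=
  (List.finRange d).foldr (fun i F => (partialDeriv i)^[k i] F) g

/-- The class `W_m^d` of functions that are `m` times continuously differentiable on the closed
cube, with `‖h‖ + ∑_{1 ≤ |k| ≤ m} ‖D^k h‖ ≤ 1`. Only the values on the cube matter. -/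
def smoothClass (m d : ℕ) : Set ((Fin d → ℝ) → ℝ) :=
  {h | ContDiffOn ℝ m h (cube d) ∧
    supNorm h + ∑ j ∈ Finset.Icc 1 m, ∑ k ∈ Finset.piAntidiag (Finset.univ : Finset (Fin d)) j,
      supNorm (multiDeriv k h) ≤ 1}

/-- The class `S_{M,d}` of shallow networks with `M` units and activation `σ`. -/
def shallow (σ : ℝ → ℝ) (M d : ℕ) : Set ((Fin d → ℝ) → ℝ) :=
  {P | ∃ (a b : Fin M → ℝ) (w : Fin M → Fin d → ℝ),
    P = fun x => ∑ k, a k * σ ((∑ i, w k i * x i) + b k)}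

/-- Binary trees whose leaves carry variable names and in which every non-leaf vertex has
exactly two (ordered) children. -/
inductive BinTree (ι : Type) : Type
  | leaf (i : ι) : BinTree ι
  | node (l r : BinTree ι) : BinTree ι

namespace BinTree

/-- The variables at the leaves, from left to right. -/
def leaves {ι : Type} : BinTree ι → List ι
  | leaf i => [i]
  | node l r => l.leaves ++ r.leaves

/-- The number `|V|` of non-leaf vertices. -/
def numInner {ι : Type} : BinTree ι → ℕ
  | leaf _ => 0
  | node l r => l.numInner + r.numInner + 1

/-- The tree is an architecture for functions of the variables `ι`: every variable sits at
exactly one leaf. -/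
def IsArchitecture {ι : Type} (t : BinTree ι) : Prop :=
  t.leaves.Nodup ∧ ∀ i, i ∈ t.leaves

/-- The functions computed by the tree when every non-leaf vertex is given its own bivariate
function from the class `S`, applied to the outputs of the two children. -/
def compositions {ι : Type} (S : Set ((Fin 2 → ℝ) → ℝ)) : BinTree ι → Set ((ι → ℝ) → ℝ)
  | leaf i => {fun x => x i}
  | node l r => {F | ∃ h ∈ S, ∃ u ∈ compositions S l, ∃ v ∈ compositions S r,
      F = fun x => h ![u x, v x]}

end BinTree

/-- The class `W_m^{n,2}` for the tree `t`: functions that are, on the cube, compositions along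
`t` of constituent functions in `W_m^2` (these map `[-1,1]^2` into `[-1,1]`). -/
def compositionalClass {n : ℕ} (t : BinTree (Fin n)) (m : ℕ) : Set ((Fin n → ℝ) → ℝ) :=
  {f | ∃ F ∈ t.compositions (smoothClass m 2), Set.EqOn f F (cube n)}

/-- The class `D_{N,2}` of deep networks with architecture `t`: every non-leaf vertex is a shallow
network in `S_{M,2}`, and `N = |V| M` is the total number of units. -/
def deep (σ : ℝ → ℝ) {n : ℕ} (t : BinTree (Fin n)) (N : ℕ) : Set ((Fin n → ℝ) → ℝ) :=
  {P | ∃ M : ℕ, N = t.numInner * M ∧ P ∈ t.compositions (shallow σ M 2)}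

end DeepNet

end

open scoped ContDiff

noncomputable section

namespace DeepNet

open Real Finset

/-! Each constituent function is replaced by a shallow network with `M = (k + 1) ^ 2` units. Two
points carry the proof: the rate `M ^ (-m / 2)` at one vertex, and an overall error that does not
grow with the tree.

Rate (`exists_shallow_near_smooth`): substituting `x = cos θ`, `y = cos φ` makes the function even
and periodic, and a tensor-product Jackson theorem (`exists_bivariate_jackson`) yields a polynomial
of coordinate degrees at most `k` with error `O(k ^ (-m))`. A monomial `x ^ a * y ^ c` is a limit of
normalized mixed differences of `σ`, taken at a bias where the relevant derivatives of `σ` do not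
vanish. All these differences use the same grid of `(k + 1) ^ 2` weights
(`exists_shallow_near_polynomial`), so the number of monomials does not matter.

Tree (`exists_composition_near`): the norm bound makes each constituent function at most 1-Lipschitz
for the maximum norm, but a fresh error at every vertex could still add up with the depth. The
remedy is an error budget `ε (1 - δ)`, with `δ` a bound for the output of the vertex. Let `A j`, `B
j` be the sup norms of the pure `j`-th derivatives of `h`. If the children have bounds `δu`, `δv`,
then `h` is approximated only on the rectangle with radii `min 1 (3 * δu)`, `min 1 (3 * δv)`, where
the local error scales with the radii (`exists_shallow_near_on_rectangle`). Its first-order part `ε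
* δu * A 1` exactly completes the inherited error `ε * (1 - δu) * A 1` to `ε * A 1`, and likewise
for `v`. The total is at most `ε * ∑ (A j + B j) ≤ ε * (1 - ‖h‖)`, which is the budget of the
parent. -/

/-! ### The Fejér–Korovkin kernel -/

/-- A cosine sum of degree at most `n`, indexed by integer frequencies. -/
def cosSum (n : ℕ) (κ : ℤ → ℝ) (t : ℝ) : ℝ :=
  ∑ k ∈ Finset.Icc (-(n : ℤ)) n, κ k * cos (k * t)

theorem continuous_cosSum (n : ℕ) (κ : ℤ → ℝ) : Continuous (cosSum n κ) := by
  unfold cosSum; fun_prop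

theorem cosSum_neg (n : ℕ) (κ : ℤ → ℝ) (t : ℝ) : cosSum n κ (-t) = cosSum n κ t := by
  simp [cosSum]

theorem integral_cos_int (k : ℤ) :
    ∫ t in -π..π, cos (k * t) = if k = 0 then 2 * π else 0 := by
  split_ifs with h
  · simp [h]; ring
  · have hk : (k : ℝ) ≠ 0 := by exact_mod_cast h
    rw [intervalIntegral.integral_comp_mul_left (fun t => cos t) hk, integral_cos]
    simp [sin_int_mul_pi]

theorem integral_cos_int_mul_cos (k : ℤ) :
    ∫ t in -π..π, cos (k * t) * cos t =
      (if k + 1 = 0 then π else 0) + (if k - 1 = 0 then π else 0) := by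
  have h : ∀ t : ℝ, cos (k * t) * cos t =
      (1 / 2) * cos ((k + 1 : ℤ) * t) + (1 / 2) * cos ((k - 1 : ℤ) * t) := by
    intro t
    push_cast
    rw [add_mul, sub_mul, one_mul, cos_add, cos_sub]
    ring
  simp_rw [h]
  rw [intervalIntegral.integral_add (by apply Continuous.intervalIntegrable; fun_prop)
    (by apply Continuous.intervalIntegrable; fun_prop),
    intervalIntegral.integral_const_mul, intervalIntegral.integral_const_mul,
    integral_cos_int, integral_cos_int]
  split_ifs <;> ring

/-- The coefficients of the square of a trigonometric polynomial, as a cosine sum. -/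
theorem exists_cosSum_eq_double_sum (n : ℕ) (a : ℕ → ℝ) : ∃ κ : ℤ → ℝ, ∀ t,
    cosSum n κ t = ∑ j ∈ range (n + 1), ∑ l ∈ range (n + 1),
      a j * a l * cos (((j : ℤ) - l : ℤ) * t) := by
  refine ⟨fun k => ∑ p ∈ (range (n + 1) ×ˢ range (n + 1)) with (p.1 : ℤ) - p.2 = k,
    a p.1 * a p.2, fun t => ?_⟩
  rw [← Finset.sum_product', ← Finset.sum_fiberwise_of_maps_to
    (t := Finset.Icc (-(n : ℤ)) n) (g := fun p : ℕ × ℕ => (p.1 : ℤ) - p.2)]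
  · unfold cosSum
    refine Finset.sum_congr rfl fun k _ => ?_
    rw [Finset.sum_mul]
    refine Finset.sum_congr rfl fun p hp => ?_
    rw [(Finset.mem_filter.mp hp).2]
  · intro p hp
    simp only [Finset.mem_product, Finset.mem_range, Finset.mem_Icc] at hp ⊢
    omega

/-- The double sum is the squared modulus of `∑ a j * exp (i j t)`. -/
theorem double_sum_cos_nonneg (n : ℕ) (a : ℕ → ℝ) (t : ℝ) :
    0 ≤ ∑ j ∈ range (n + 1), ∑ l ∈ range (n + 1), a j * a l * cos (((j : ℤ) - l : ℤ) * t) := by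
  have : ∑ j ∈ range (n + 1), ∑ l ∈ range (n + 1), a j * a l * cos (((j : ℤ) - l : ℤ) * t) =
      (∑ j ∈ range (n + 1), a j * cos (j * t)) ^ 2 +
        (∑ j ∈ range (n + 1), a j * sin (j * t)) ^ 2 := by
    rw [sq, sq, Finset.sum_mul_sum, Finset.sum_mul_sum, ← Finset.sum_add_distrib]
    refine Finset.sum_congr rfl fun j _ => ?_
    rw [← Finset.sum_add_distrib]
    refine Finset.sum_congr rfl fun l _ => ?_
    push_cast
    rw [sub_mul, cos_sub]
    ring
  rw [this]; positivity

theorem integral_double_sum {n : ℕ} (a : ℕ → ℝ) (g : ℝ → ℝ) (hg : Continuous g) :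
    ∫ t in -π..π, (∑ j ∈ range (n + 1), ∑ l ∈ range (n + 1),
      a j * a l * cos (((j : ℤ) - l : ℤ) * t)) * g t =
    ∑ j ∈ range (n + 1), ∑ l ∈ range (n + 1),
      a j * a l * ∫ t in -π..π, cos (((j : ℤ) - l : ℤ) * t) * g t := by
  simp_rw [Finset.sum_mul]
  rw [intervalIntegral.integral_finsetSum
    (fun _ _ => by apply Continuous.intervalIntegrable; fun_prop)]
  refine Finset.sum_congr rfl fun j _ => ?_
  rw [intervalIntegral.integral_finsetSum
    (fun _ _ => by apply Continuous.intervalIntegrable; fun_prop)]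
  refine Finset.sum_congr rfl fun l _ => ?_
  simp_rw [mul_assoc]
  rw [intervalIntegral.integral_const_mul, intervalIntegral.integral_const_mul]

/-- The sine sequence is an eigenvector of the path adjacency matrix. -/
theorem sum_sine_neighbours (n : ℕ) (j : ℕ) (hj : j ∈ range (n + 1)) :
    ∑ l ∈ range (n + 1), sin ((l + 1) * (π / (n + 2))) *
      ((if (j : ℤ) - l + 1 = 0 then π else 0) + (if (j : ℤ) - l - 1 = 0 then π else 0)) =
    2 * π * cos (π / (n + 2)) * sin ((j + 1) * (π / (n + 2))) := by
  have hj' := Finset.mem_range.mp hj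
  have e1 : ∑ l ∈ range (n + 1), sin ((l + 1) * (π / (n + 2))) *
      (if (j : ℤ) - l + 1 = 0 then π else 0) = sin ((j + 2) * (π / (n + 2))) * π := by
    by_cases h : j + 1 < n + 1
    · rw [Finset.sum_eq_single_of_mem (j + 1) (Finset.mem_range.mpr h)]
      · simp only [Nat.cast_add, Nat.cast_one]
        rw [if_pos (by ring)]
        ring_nf
      · intro l _ hl
        rw [if_neg (by omega), mul_zero]
    -- The missing right neighbour would contribute `sin π = 0`; at the other end, `j = 0`, the
    -- missing one contributes `sin 0 = 0`.
    · have : j = n := by omega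
      subst this
      rw [Finset.sum_eq_zero]
      · rw [mul_div_cancel₀ _ (by positivity), sin_pi, zero_mul]
      · intro l hl
        rw [if_neg (by have := Finset.mem_range.mp hl; omega), mul_zero]
  have e2 : ∑ l ∈ range (n + 1), sin ((l + 1) * (π / (n + 2))) *
      (if (j : ℤ) - l - 1 = 0 then π else 0) = sin (j * (π / (n + 2))) * π := by
    rcases j with _ | j
    · rw [Finset.sum_eq_zero]
      · simp
      · intro l hl
        rw [if_neg (by omega), mul_zero]
    · rw [Finset.sum_eq_single_of_mem j (Finset.mem_range.mpr (by omega))]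
      · rw [if_pos (by push_cast; ring)]
        push_cast
        ring_nf
      · intro l _ hl
        rw [if_neg (by omega), mul_zero]
  simp_rw [mul_add]
  rw [Finset.sum_add_distrib, e1, e2]
  have h1 : ((j : ℝ) + 2) * (π / (n + 2)) = (j + 1) * (π / (n + 2)) + π / (n + 2) := by ring
  have h2 : (j : ℝ) * (π / (n + 2)) = (j + 1) * (π / (n + 2)) - π / (n + 2) := by ring
  rw [h1, h2, sin_add, sin_sub]
  ring

/-- A nonnegative kernel whose first Fourier coefficient is close to its mass has small first
absolute moment. -/
theorem integral_abs_mul_le_of_integral_cos {K : ℝ → ℝ} (hK : Continuous K) (hnn : ∀ t, 0 ≤ K t)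
    {N : ℝ} (hN : 0 < N) (h0 : ∫ t in -π..π, K t = 1)
    (h1 : ∫ t in -π..π, K t * cos t = cos (π / N)) :
    ∫ t in -π..π, |t| * K t ≤ (1 / 2 + π ^ 4 / 8) / N := by
  have key : ∫ t in -π..π, |t| * K t ≤
      ∫ t in -π..π, ((1 / 2 * (1 / N) + N * π ^ 2 / 4) * K t -
        (N * π ^ 2 / 4) * (K t * cos t)) := by
    apply intervalIntegral.integral_mono_on (by linarith [pi_pos])
      (by apply Continuous.intervalIntegrable; fun_prop)
      (by apply Continuous.intervalIntegrable; fun_prop)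
    intro t ht
    -- AM-GM balanced at `|t| = 1 / N`, the width of the kernel; `t ^ 2` is then dominated by `1 -
    -- cos t`, whose integral against `K` is known.
    have h1 : |t| ≤ 1 / 2 * (1 / N) + 1 / 2 * (N * t ^ 2) := by
      have h : 0 ≤ (1 - N * |t|) ^ 2 / N := by positivity
      have e : (1 - N * |t|) ^ 2 / N = 1 / N - 2 * |t| + N * t ^ 2 := by
        rw [← sq_abs t]; field_simp; ring
      linarith
    have h2 : cos t ≤ 1 - 2 / π ^ 2 * t ^ 2 := cos_le_one_sub_mul_cos_sq (abs_le.mpr ht)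
    have h3 : t ^ 2 ≤ π ^ 2 / 2 * (1 - cos t) := by
      have e : π ^ 2 / 2 * (2 / π ^ 2 * t ^ 2) = t ^ 2 := by field_simp
      rw [← e]
      exact mul_le_mul_of_nonneg_left (by linarith) (by positivity)
    have h4 : |t| ≤ (1 / 2 * (1 / N) + N * π ^ 2 / 4) - (N * π ^ 2 / 4) * cos t := by
      have := mul_le_mul_of_nonneg_left h3 (by positivity : 0 ≤ 1 / 2 * N)
      linarith
    calc |t| * K t ≤ ((1 / 2 * (1 / N) + N * π ^ 2 / 4) - (N * π ^ 2 / 4) * cos t) * K t :=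
          mul_le_mul_of_nonneg_right h4 (hnn t)
      _ = _ := by ring
  refine key.trans ?_
  rw [intervalIntegral.integral_sub
    (by apply Continuous.intervalIntegrable; fun_prop)
    (by apply Continuous.intervalIntegrable; fun_prop),
    intervalIntegral.integral_const_mul, intervalIntegral.integral_const_mul, h0, h1]
  have h5 : 1 - cos (π / N) ≤ (π / N) ^ 2 / 2 := by
    linarith [one_sub_sq_div_two_le_cos (x := π / N)]
  have h6 : N * π ^ 2 / 4 * (1 - cos (π / N)) ≤ N * π ^ 2 / 4 * ((π / N) ^ 2 / 2) := by
    gcongr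
  have h7 : N * π ^ 2 / 4 * ((π / N) ^ 2 / 2) = π ^ 4 / 8 / N := by
    field_simp; ring
  rw [h7] at h6
  calc _ ≤ 1 / 2 * (1 / N) + π ^ 4 / 8 / N := by linarith
    _ = _ := by ring

/-- The Fejér–Korovkin kernel: a nonnegative normalized cosine sum of degree `n` with first
absolute moment `O(1 / n)`. -/
theorem exists_kernel (n : ℕ) : ∃ κ : ℤ → ℝ, (∀ t, 0 ≤ cosSum n κ t) ∧
    ∫ t in -π..π, cosSum n κ t = 1 ∧
    ∫ t in -π..π, |t| * cosSum n κ t ≤ (1 / 2 + π ^ 4 / 8) / (n + 2) := by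
  set N : ℝ := n + 2 with hN
  have hNpos : 0 < N := by positivity
  -- This is the top eigenvector of the path on `n + 1` vertices; it maximizes the ratio of first
  -- Fourier coefficient to mass, with value `cos (π / N)`.
  set a : ℕ → ℝ := fun j => sin ((j + 1) * (π / N)) with ha
  set A : ℝ := ∑ j ∈ range (n + 1), a j ^ 2 with hA
  have ha0 : 0 < a 0 := by
    simp only [ha, Nat.cast_zero, zero_add, one_mul]
    apply sin_pos_of_pos_of_lt_pi (by positivity)
    apply div_lt_self pi_pos
    have : (0 : ℝ) ≤ n := n.cast_nonneg
    linarith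
  have hApos : 0 < A := by
    apply Finset.sum_pos' (fun j _ => sq_nonneg _)
    exact ⟨0, by simp, by positivity⟩
  obtain ⟨κ₀, hκ₀⟩ := exists_cosSum_eq_double_sum n a
  have hI0 : ∫ t in -π..π, cosSum n κ₀ t = 2 * π * A := by
    have := integral_double_sum (n := n) a (fun _ => 1) continuous_const
    simp only [mul_one] at this
    simp_rw [hκ₀]
    rw [this, hA, Finset.mul_sum]
    refine Finset.sum_congr rfl fun j hj => ?_
    rw [Finset.sum_eq_single_of_mem j hj]
    · rw [integral_cos_int, if_pos (by simp)]; ring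
    · intro l _ hl
      rw [integral_cos_int, if_neg (by omega), mul_zero]
  have hI1 : ∫ t in -π..π, cosSum n κ₀ t * cos t = 2 * π * cos (π / N) * A := by
    have := integral_double_sum (n := n) a (fun t => cos t) continuous_cos
    simp_rw [hκ₀]
    rw [this, hA, Finset.mul_sum]
    refine Finset.sum_congr rfl fun j hj => ?_
    simp_rw [integral_cos_int_mul_cos, mul_assoc]
    rw [← Finset.mul_sum]
    have := sum_sine_neighbours n j hj
    simp only [ha, hN]
    rw [this]
    ring
  have hnn : ∀ t, 0 ≤ cosSum n κ₀ t := fun t => by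
    rw [hκ₀]; exact double_sum_cos_nonneg n a t
  have hsc : ∀ t, cosSum n (fun k => κ₀ k / (2 * π * A)) t = cosSum n κ₀ t / (2 * π * A) := by
    intro t
    simp only [cosSum, Finset.sum_div]
    exact Finset.sum_congr rfl fun k _ => by ring
  clear_value A N
  have hP : 0 < 2 * π * A := mul_pos two_pi_pos hApos
  refine ⟨fun k => κ₀ k / (2 * π * A), fun t => ?_, ?_, ?_⟩
  · rw [hsc]; exact div_nonneg (hnn t) hP.le
  · simp_rw [hsc]
    rw [intervalIntegral.integral_div, hI0, div_self hP.ne']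
  · simp_rw [hsc]
    refine integral_abs_mul_le_of_integral_cos (K := fun t => cosSum n κ₀ t / (2 * π * A))
      ((continuous_cosSum n κ₀).div_const _) (fun t => div_nonneg (hnn t) hP.le) hNpos ?_ ?_
    · rw [intervalIntegral.integral_div, hI0, div_self hP.ne']
    · simp_rw [div_mul_eq_mul_div]
      rw [intervalIntegral.integral_div, hI1]
      field_simp

/-! ### Iterated convolution defects -/

/-- The defect `f - K ∗ f` of the convolution with `K` over a period. -/
def defect (K f : ℝ → ℝ) (θ : ℝ) : ℝ := f θ - ∫ t in -π..π, f (θ - t) * K t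

theorem continuous_defect {K f : ℝ → ℝ} (hK : Continuous K) (hf : Continuous f) :
    Continuous (defect K f) := by
  unfold defect
  refine hf.sub (intervalIntegral.continuous_parametric_intervalIntegral_of_continuous' ?_ _ _)
  unfold Function.uncurry
  fun_prop

/-- Differentiation under the integral sign: the defect operator commutes with the derivative. -/
theorem hasDerivAt_defect {K f f' : ℝ → ℝ} (hK : Continuous K) (hf' : Continuous f')
    (h : ∀ θ, HasDerivAt f (f' θ) θ) (θ : ℝ) : HasDerivAt (defect K f) (defect K f' θ) θ := by
  have hf : Continuous f := continuous_iff_continuousAt.mpr fun x => (h x).continuousAt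
  have hcont : Continuous fun p : ℝ × ℝ => f' (p.1 - p.2) * K p.2 := by fun_prop
  obtain ⟨B, hB⟩ := ((isCompact_closedBall θ 1).prod (isCompact_Icc (a := -π) (b := π))
    ).exists_bound_of_continuousOn hcont.continuousOn
  refine (h θ).sub (intervalIntegral.hasDerivAt_integral_of_dominated_loc_of_deriv_le
    (F := fun θ t => f (θ - t) * K t) (F' := fun θ t => f' (θ - t) * K t)
    (bound := fun _ => B) (Metric.closedBall_mem_nhds θ one_pos) ?_ ?_ ?_ ?_ ?_ ?_).2
  · filter_upwards with x
    have : Continuous fun t => f (x - t) * K t := by fun_prop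
    exact this.aestronglyMeasurable
  · apply Continuous.intervalIntegrable; fun_prop
  · have : Continuous fun t => f' (θ - t) * K t := by fun_prop
    exact this.aestronglyMeasurable
  · filter_upwards with t ht x hx
    rw [Set.uIoc_of_le (by linarith [pi_pos])] at ht
    exact hB (x, t) ⟨hx, Set.Ioc_subset_Icc_self ht⟩
  · exact intervalIntegrable_const
  · filter_upwards with t _ x _
    have := (h (x - t)).comp x ((hasDerivAt_id x).sub_const t)
    rw [mul_one] at this
    exact this.mul_const _

theorem hasDerivAt_defect_iterate {K f f' : ℝ → ℝ} (hK : Continuous K) (hf' : Continuous f')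
    (h : ∀ θ, HasDerivAt f (f' θ) θ) (m : ℕ) (θ : ℝ) :
    HasDerivAt ((defect K)^[m] f) ((defect K)^[m] f' θ) θ := by
  induction m generalizing f f' with
  | zero => exact h θ
  | succ m ih =>
    exact ih (continuous_defect hK hf') (fun x => hasDerivAt_defect hK hf' h x)

theorem abs_defect_le {K f : ℝ → ℝ} (hK : Continuous K) (hnn : ∀ t, 0 ≤ K t)
    (h1 : ∫ t in -π..π, K t = 1) (hf : Continuous f) {B : ℝ} (hB : ∀ θ, |f θ| ≤ B) (θ : ℝ) :
    |defect K f θ| ≤ 2 * B := by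
  have h : |∫ t in -π..π, f (θ - t) * K t| ≤ ∫ t in -π..π, B * K t := by
    refine (intervalIntegral.abs_integral_le_integral_abs (by linarith [pi_pos])).trans ?_
    refine intervalIntegral.integral_mono_on (by linarith [pi_pos])
      (by apply Continuous.intervalIntegrable; fun_prop)
      (by apply Continuous.intervalIntegrable; fun_prop) fun t _ => ?_
    rw [abs_mul, abs_of_nonneg (hnn t)]
    exact mul_le_mul_of_nonneg_right (hB _) (hnn t)
  rw [intervalIntegral.integral_const_mul, h1, mul_one] at h
  unfold defect
  linarith [abs_sub (f θ) (∫ t in -π..π, f (θ - t) * K t), hB θ]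

theorem abs_defect_iterate_le {K f : ℝ → ℝ} (hK : Continuous K) (hnn : ∀ t, 0 ≤ K t)
    (h1 : ∫ t in -π..π, K t = 1) (hf : Continuous f) {B : ℝ} (hB : ∀ θ, |f θ| ≤ B) (m : ℕ)
    (θ : ℝ) : |(defect K)^[m] f θ| ≤ 2 ^ m * B := by
  induction m generalizing f B with
  | zero => simpa using hB θ
  | succ m ih =>
    have := ih (continuous_defect hK hf) (abs_defect_le hK hnn h1 hf hB)
    rw [Function.iterate_succ_apply]
    calc _ ≤ 2 ^ m * (2 * B) := this
      _ = _ := by ring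

/-- As `K` has mass one, the defect is the average of `f θ - f (θ - t)`, and the mean value
inequality bounds this by `B * |t|`. -/
theorem abs_defect_le_of_deriv {K f f' : ℝ → ℝ} (hK : Continuous K) (hnn : ∀ t, 0 ≤ K t)
    (h1 : ∫ t in -π..π, K t = 1) {μ : ℝ} (hμ : ∫ t in -π..π, |t| * K t ≤ μ)
    (h : ∀ θ, HasDerivAt f (f' θ) θ) {B : ℝ} (hB : ∀ θ, |f' θ| ≤ B) (θ : ℝ) :
    |defect K f θ| ≤ μ * B := by
  have hf : Continuous f := continuous_iff_continuousAt.mpr fun x => (h x).continuousAt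
  have hB0 : 0 ≤ B := (abs_nonneg _).trans (hB 0)
  have e : defect K f θ = ∫ t in -π..π, (f θ - f (θ - t)) * K t := by
    simp_rw [sub_mul]
    rw [intervalIntegral.integral_sub (by apply Continuous.intervalIntegrable; fun_prop)
      (by apply Continuous.intervalIntegrable; fun_prop), intervalIntegral.integral_const_mul,
      h1, mul_one, defect]
  rw [e]
  calc _ ≤ ∫ t in -π..π, |(f θ - f (θ - t)) * K t| :=
        intervalIntegral.abs_integral_le_integral_abs (by linarith [pi_pos])
    _ ≤ ∫ t in -π..π, B * (|t| * K t) := by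
        refine intervalIntegral.integral_mono_on (by linarith [pi_pos])
          (by apply Continuous.intervalIntegrable; fun_prop)
          (by apply Continuous.intervalIntegrable; fun_prop) fun t _ => ?_
        rw [abs_mul, abs_of_nonneg (hnn t), ← mul_assoc]
        refine mul_le_mul_of_nonneg_right ?_ (hnn t)
        have := convex_univ.norm_image_sub_le_of_norm_hasDerivWithin_le
          (f := f) (f' := f') (C := B) (x := θ - t) (y := θ)
          (fun x _ => (h x).hasDerivWithinAt) (fun x _ => hB x) trivial trivial
        simpa using this
    _ ≤ μ * B := by
        rw [intervalIntegral.integral_const_mul, mul_comm]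
        exact mul_le_mul_of_nonneg_right hμ hB0

/-- Each application of the defect trades one derivative for a factor `μ`. -/
theorem abs_defect_iterate_le_of_deriv {K : ℝ → ℝ} (hK : Continuous K) (hnn : ∀ t, 0 ≤ K t)
    (h1 : ∫ t in -π..π, K t = 1) {μ : ℝ} (hμ : ∫ t in -π..π, |t| * K t ≤ μ) {B : ℝ} (m : ℕ)
    (F : ℕ → ℝ → ℝ) (hF : ∀ j < m, ∀ θ, HasDerivAt (F j) (F (j + 1) θ) θ)
    (hc : Continuous (F m)) (hB : ∀ θ, |F m θ| ≤ B) (θ : ℝ) :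
    |(defect K)^[m] (F 0) θ| ≤ μ ^ m * B := by
  induction m generalizing F θ with
  | zero => simpa using hB θ
  | succ m ih =>
    have hF1 : Continuous (F 1) := by
      rcases m with _ | m
      · exact hc
      · exact continuous_iff_continuousAt.mpr fun x => (hF 1 (by omega) x).continuousAt
    -- The outermost defect is estimated by the derivative of the inner iterate, which is the same
    -- iterate applied to `F 1`; the induction hypothesis applies to the shifted tower.
    rw [Function.iterate_succ_apply']
    have := abs_defect_le_of_deriv hK hnn h1 hμ
      (hasDerivAt_defect_iterate hK hF1 (hF 0 (by omega)) m)
      (ih (fun j => F (j + 1)) (fun j hj => hF (j + 1) (by omega)) hc hB) θ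
    calc _ ≤ μ * (μ ^ m * B) := this
      _ = _ := by ring

/-! ### Fourier multipliers and Jackson's theorem in one variable -/

/-- Continuous even `2π`-periodic functions. -/
structure IsEvenPeriodic (f : ℝ → ℝ) : Prop where
  continuous : Continuous f
  even : ∀ θ, f (-θ) = f θ
  periodic : Function.Periodic f (2 * π)

theorem integral_odd_eq_zero {f : ℝ → ℝ} (hf : ∀ t, f (-t) = -f t) (a : ℝ) :
    ∫ t in -a..a, f t = 0 := by
  have h := intervalIntegral.integral_comp_neg (a := -a) (b := a) f
  simp only [hf, intervalIntegral.integral_neg, neg_neg] at h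
  linarith

theorem integral_mul_cos_sub {f : ℝ → ℝ} (hf : Continuous f) (he : ∀ t, f (-t) = f t) (k : ℤ)
    (θ : ℝ) : ∫ t in -π..π, f t * cos (k * (θ - t)) =
      (∫ t in -π..π, f t * cos (k * t)) * cos (k * θ) := by
  have h : ∀ t, f t * cos (k * (θ - t)) =
      f t * cos (k * t) * cos (k * θ) + f t * sin (k * t) * sin (k * θ) := by
    intro t; rw [mul_sub, cos_sub]; ring
  simp_rw [h]
  rw [intervalIntegral.integral_add (by apply Continuous.intervalIntegrable; fun_prop)
    (by apply Continuous.intervalIntegrable; fun_prop), intervalIntegral.integral_mul_const,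
    intervalIntegral.integral_mul_const,
    integral_odd_eq_zero (f := fun t => f t * sin (k * t)) (fun t => by simp [he])]
  ring

/-- Convolving an even periodic function with a cosine sum acts as a Fourier multiplier. -/
theorem integral_comp_sub_mul_cosSum {f : ℝ → ℝ} (hf : IsEvenPeriodic f) (n : ℕ) (κ : ℤ → ℝ)
    (θ : ℝ) : ∫ t in -π..π, f (θ - t) * cosSum n κ t =
      cosSum n (fun k => κ k * ∫ t in -π..π, f t * cos (k * t)) θ := by
  have hc := hf.continuous
  have hK := continuous_cosSum n κ
  have hper : Function.Periodic (fun t => f t * cosSum n κ (θ - t)) (2 * π) := by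
    intro t
    simp only [hf.periodic t, cosSum]
    congr 1
    refine Finset.sum_congr rfl fun k _ => ?_
    rw [show (k : ℝ) * (θ - (t + 2 * π)) = k * (θ - t) - k * (2 * π) by ring,
      cos_sub_int_mul_two_pi]
  -- The substitution `t ↦ θ - t` shifts the window of integration; periodicity shifts it back.
  have e1 := intervalIntegral.integral_comp_sub_left (a := -π) (b := π)
    (fun t => f t * cosSum n κ (θ - t)) θ
  simp only [sub_sub_cancel] at e1
  have e2 := hper.intervalIntegral_add_eq (θ - π) (-π)
  rw [show θ - π + 2 * π = θ - -π by ring, show -π + 2 * π = π by ring] at e2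
  rw [e1, e2]
  simp only [cosSum, Finset.mul_sum]
  rw [intervalIntegral.integral_finsetSum
    (fun _ _ => by apply Continuous.intervalIntegrable; fun_prop)]
  refine Finset.sum_congr rfl fun k _ => ?_
  rw [mul_assoc, ← integral_mul_cos_sub hc hf.even, ← intervalIntegral.integral_const_mul]
  congr 1; ext t; ring

/-- Functions of the form `f` minus a cosine sum of degree `n` are stable under the defect; this is
the inductive step for its iterates. -/
theorem defect_sub_cosSum {f : ℝ → ℝ} (hf : IsEvenPeriodic f) (n : ℕ) (κ γ : ℤ → ℝ) :
    defect (cosSum n κ) (fun θ => f θ - cosSum n γ θ) = fun θ => f θ - cosSum n (fun k =>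
      κ k * (∫ t in -π..π, f t * cos (k * t)) +
        γ k * (1 - ∫ t in -π..π, cosSum n κ t * cos (k * t))) θ := by
  have hc := hf.continuous
  have hK := continuous_cosSum n κ
  have hG := continuous_cosSum n γ
  ext θ
  have e : ∫ t in -π..π, cosSum n γ (θ - t) * cosSum n κ t =
      cosSum n (fun k => γ k * ∫ t in -π..π, cosSum n κ t * cos (k * t)) θ := by
    simp only [cosSum.eq_def n γ, Finset.sum_mul]
    rw [intervalIntegral.integral_finsetSum
      (fun _ _ => by apply Continuous.intervalIntegrable; fun_prop), cosSum]
    refine Finset.sum_congr rfl fun k _ => ?_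
    rw [mul_assoc, ← integral_mul_cos_sub hK (cosSum_neg n κ),
      ← intervalIntegral.integral_const_mul]
    congr 1; ext t; ring
  simp only [defect, sub_mul]
  rw [intervalIntegral.integral_sub (by apply Continuous.intervalIntegrable; fun_prop)
      (by apply Continuous.intervalIntegrable; fun_prop), e, integral_comp_sub_mul_cosSum hf]
  simp only [cosSum, sub_sub]
  congr 1
  rw [← sub_eq_zero]
  simp only [← Finset.sum_add_distrib, ← Finset.sum_sub_distrib]
  exact Finset.sum_eq_zero fun k _ => by ring

/-- The multiplier `β` is chosen before `f`. The approximation is therefore linear in `f`, which the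
passage to two variables needs. -/
theorem exists_defect_iterate_eq (n : ℕ) (κ : ℤ → ℝ) (m : ℕ) : ∃ β : ℤ → ℝ,
    ∀ f, IsEvenPeriodic f → (defect (cosSum n κ))^[m] f =
      fun θ => f θ - cosSum n (fun k => β k * ∫ t in -π..π, f t * cos (k * t)) θ := by
  induction m with
  | zero => exact ⟨0, fun f _ => by ext θ; simp [cosSum]⟩
  | succ m ih =>
    obtain ⟨β, hβ⟩ := ih
    refine ⟨fun k => κ k + β k * (1 - ∫ t in -π..π, cosSum n κ t * cos (k * t)),
      fun f hf => ?_⟩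
    rw [Function.iterate_succ_apply', hβ f hf, defect_sub_cosSum hf]
    ext θ
    simp only [cosSum]
    congr 1
    exact Finset.sum_congr rfl fun k _ => by ring

/-- Jackson's theorem in the form of uniformly bounded Fourier multiplier operators. -/
theorem exists_jackson_multiplier (m : ℕ) : ∃ c : ℝ, 0 < c ∧ ∀ n : ℕ, ∃ β : ℤ → ℝ,
    ∀ f, IsEvenPeriodic f →
      (∀ B, (∀ θ, |f θ| ≤ B) → ∀ θ,
        |f θ - cosSum n (fun k => β k * ∫ t in -π..π, f t * cos (k * t)) θ| ≤ 2 ^ m * B) ∧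
      (∀ (F : ℕ → ℝ → ℝ) (B : ℝ), F 0 = f →
        (∀ j < m, ∀ θ, HasDerivAt (F j) (F (j + 1) θ) θ) → Continuous (F m) →
        (∀ θ, |F m θ| ≤ B) → ∀ θ,
        |f θ - cosSum n (fun k => β k * ∫ t in -π..π, f t * cos (k * t)) θ| ≤
          c / ((n : ℝ) + 2) ^ m * B) := by
  refine ⟨(1 / 2 + π ^ 4 / 8) ^ m, by positivity, fun n => ?_⟩
  obtain ⟨κ, hnn, h1, hμ⟩ := exists_kernel n
  have hK := continuous_cosSum n κ
  obtain ⟨β, hβ⟩ := exists_defect_iterate_eq n κ m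
  refine ⟨β, fun f hf => ⟨fun B hB θ => ?_, fun F B hF0 hF hc hB θ => ?_⟩⟩
  · have := abs_defect_iterate_le hK hnn h1 hf.continuous hB m θ
    rwa [hβ f hf] at this
  · have := abs_defect_iterate_le_of_deriv hK hnn h1 hμ m F hF hc hB θ
    rwa [hF0, hβ f hf, div_pow] at this

/-! ### The substitution `x = cos θ` and Jackson's theorem in two variables -/

/-- `u` is `m` times continuously differentiable on `[-1, 1]` and its derivatives of orders
`1, …, m` are bounded by `S` there. -/
def SmoothBy (m : ℕ) (S : ℝ) (u : ℝ → ℝ) : Prop :=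
  ∃ p : ℕ → ℝ → ℝ, p 0 = u ∧
    (∀ j < m, ∀ x ∈ Set.Icc (-1 : ℝ) 1, HasDerivWithinAt (p j) (p (j + 1) x) (Set.Icc (-1) 1) x) ∧
    ContinuousOn (p m) (Set.Icc (-1) 1) ∧
    ∀ j, 1 ≤ j → j ≤ m → ∀ x ∈ Set.Icc (-1 : ℝ) 1, |p j x| ≤ S

theorem uniqueDiffOn_Icc_neg_one_one : UniqueDiffOn ℝ (Set.Icc (-1 : ℝ) 1) :=
  uniqueDiffOn_Icc (by norm_num)

theorem iteratedDerivWithin_eq_of_tower {m : ℕ} {p : ℕ → ℝ → ℝ}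
    (hp : ∀ j < m, ∀ x ∈ Set.Icc (-1 : ℝ) 1,
      HasDerivWithinAt (p j) (p (j + 1) x) (Set.Icc (-1) 1) x) {j : ℕ} (hj : j ≤ m) :
    Set.EqOn (iteratedDerivWithin j (p 0) (Set.Icc (-1) 1)) (p j) (Set.Icc (-1) 1) := by
  induction j with
  | zero => intro x _; simp
  | succ j ih =>
    intro x hx
    rw [iteratedDerivWithin_succ, derivWithin_congr (ih (by omega)) (ih (by omega) hx)]
    exact (hp j hj x hx).derivWithin (uniqueDiffOn_Icc_neg_one_one x hx)

theorem contDiffOn_of_tower {m : ℕ} {p : ℕ → ℝ → ℝ}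
    (hp : ∀ j < m, ∀ x ∈ Set.Icc (-1 : ℝ) 1,
      HasDerivWithinAt (p j) (p (j + 1) x) (Set.Icc (-1) 1) x)
    (hc : ContinuousOn (p m) (Set.Icc (-1) 1)) :
    ContDiffOn ℝ m (p 0) (Set.Icc (-1) 1) := by
  have hcj : ∀ j ≤ m, ContinuousOn (p j) (Set.Icc (-1) 1) := by
    intro j hj
    rcases hj.lt_or_eq with h | rfl
    · exact fun x hx => (hp j h x hx).continuousWithinAt
    · exact hc
  have := contDiffOn_of_continuousOn_differentiableOn_deriv (𝕜 := ℝ) (n := (m : ℕ∞)) (f := p 0)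
    (s := Set.Icc (-1 : ℝ) 1) (fun j hj => ?_) (fun j hj => ?_)
  · exact_mod_cast this
  · have hj' : j ≤ m := by exact_mod_cast hj
    exact (hcj j hj').congr (iteratedDerivWithin_eq_of_tower hp hj')
  · have hj' : j < m := by exact_mod_cast hj
    refine DifferentiableOn.congr (f := p j) (fun x hx => (hp j hj' x hx).differentiableWithinAt)
      (iteratedDerivWithin_eq_of_tower hp hj'.le)

theorem SmoothBy.continuousOn {m : ℕ} {S : ℝ} {u : ℝ → ℝ} (h : SmoothBy m S u) :
    ContinuousOn u (Set.Icc (-1) 1) := by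
  obtain ⟨p, rfl, hp, hc, -⟩ := h
  exact (contDiffOn_of_tower hp hc).continuousOn

/-- All derivatives of `cos` are bounded by one, so the norm estimate for the derivatives of a
composition costs only a factor `m!`. -/
theorem SmoothBy.exists_tower_comp_cos {m : ℕ} (hm : 1 ≤ m) {S : ℝ} {u : ℝ → ℝ}
    (h : SmoothBy m S u) : ∃ F : ℕ → ℝ → ℝ, F 0 = (fun θ => u (cos θ)) ∧
      (∀ j < m, ∀ θ, HasDerivAt (F j) (F (j + 1) θ) θ) ∧ Continuous (F m) ∧
      ∀ θ, |F m θ| ≤ m.factorial * S := by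
  obtain ⟨p, rfl, hp, hc, hS⟩ := h
  -- The composition estimate also needs a bound at order zero. Subtracting the value at `0` makes
  -- `S` such a bound; the constant returns only in `F 0`, and `F m` is unaffected since `m ≥ 1`.
  set p' : ℕ → ℝ → ℝ := fun j x => p j x - if j = 0 then p 0 0 else 0 with hp'
  have hd : ∀ j < m, ∀ x ∈ Set.Icc (-1 : ℝ) 1,
      HasDerivWithinAt (p' j) (p' (j + 1) x) (Set.Icc (-1) 1) x := by
    intro j hj x hx
    simpa [hp'] using (hp j hj x hx).sub_const (if j = 0 then p 0 0 else 0)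
  have hc' : ContinuousOn (p' m) (Set.Icc (-1) 1) := hc.sub continuousOn_const
  have hcd := contDiffOn_of_tower hd hc'
  have hmaps : Set.MapsTo cos Set.univ (Set.Icc (-1) 1) := fun θ _ => cos_mem_Icc θ
  have hcomp : ContDiff ℝ m (p' 0 ∘ cos) := by
    rw [← contDiffOn_univ]
    exact hcd.comp contDiff_cos.contDiffOn hmaps
  refine ⟨fun j θ => iteratedDeriv j (p' 0 ∘ cos) θ + if j = 0 then p 0 0 else 0, ?_, ?_, ?_, ?_⟩
  · ext θ; simp [hp']
  · intro j hj θ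
    simp only [Nat.add_eq_zero_iff, one_ne_zero, and_false, if_false, add_zero]
    rw [iteratedDeriv_succ]
    exact ((hcomp.differentiable_iteratedDeriv j (by exact_mod_cast hj)) θ).hasDerivAt.add_const _
  · exact (hcomp.continuous_iteratedDeriv m le_rfl).add continuous_const
  · intro θ
    simp only [show m ≠ 0 by omega, if_false, add_zero]
    have := norm_iteratedFDerivWithin_comp_le (n := m) (x := θ) (C := S) (D := 1) hcd
      (contDiff_cos.contDiffOn (s := Set.univ) (n := m)) le_rfl uniqueDiffOn_Icc_neg_one_one
      uniqueDiffOn_univ hmaps trivial ?_ ?_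
    · rw [iteratedFDerivWithin_univ, norm_iteratedFDeriv_eq_norm_iteratedDeriv, one_pow,
        mul_one] at this
      exact this
    · intro j hj
      rw [norm_iteratedFDerivWithin_eq_norm_iteratedDerivWithin,
        iteratedDerivWithin_eq_of_tower hd hj (hmaps trivial)]
      rcases Nat.eq_zero_or_pos j with rfl | h0
      · have h1 := (convex_Icc (-1 : ℝ) 1).norm_image_sub_le_of_norm_hasDerivWithin_le
          (f := p 0) (f' := p 1) (C := S) (x := 0) (y := cos θ) (hp 0 hm) (hS 1 le_rfl hm)
          (by simp) (cos_mem_Icc θ)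
        have hS0 : 0 ≤ S := (abs_nonneg _).trans (hS 1 le_rfl hm 0 (by simp))
        simp only [hp', if_true]
        refine h1.trans ?_
        rw [sub_zero]
        exact mul_le_of_le_one_right hS0 (abs_cos_le_one θ)
      · simp only [hp', h0.ne', if_false, sub_zero]
        exact hS j h0 hj _ (cos_mem_Icc θ)
    · intro j _ _
      rw [iteratedFDerivWithin_univ, norm_iteratedFDeriv_eq_norm_iteratedDeriv, one_pow]
      exact abs_iteratedDeriv_cos_le_one j θ

theorem isEvenPeriodic_comp_cos {u : ℝ → ℝ} (hu : ContinuousOn u (Set.Icc (-1) 1)) :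
    IsEvenPeriodic fun θ => u (cos θ) where
  continuous := hu.comp_continuous continuous_cos cos_mem_Icc
  even θ := by simp
  periodic θ := by simp

/-- Jackson's theorem for functions of two variables, by tensor products of multipliers. -/
theorem exists_bivariate_jackson (m : ℕ) (hm : 1 ≤ m) : ∃ C : ℝ, 0 < C ∧
    ∀ (n : ℕ) (g : ℝ → ℝ → ℝ) (S : ℝ),
      ContinuousOn (Function.uncurry g) (Set.Icc (-1) 1 ×ˢ Set.Icc (-1) 1) →
      (∀ y ∈ Set.Icc (-1 : ℝ) 1, SmoothBy m S fun x => g x y) →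
      (∀ x ∈ Set.Icc (-1 : ℝ) 1, SmoothBy m S (g x)) →
      ∃ γ : ℤ → ℤ → ℝ, ∀ θ φ : ℝ, |g (cos θ) (cos φ) -
        ∑ k ∈ Finset.Icc (-(n : ℤ)) n, ∑ l ∈ Finset.Icc (-(n : ℤ)) n,
          γ k l * cos (k * θ) * cos (l * φ)| ≤ C / ((n : ℝ) + 2) ^ m * S := by
  obtain ⟨c, hc, hjack⟩ := exists_jackson_multiplier m
  refine ⟨(2 ^ m + 2) * (c * m.factorial), by positivity, fun n g S hg hx hy => ?_⟩
  obtain ⟨β, hβ⟩ := hjack n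
  set G : ℝ → ℝ → ℝ := fun θ φ => g (cos θ) (cos φ) with hG
  have hGc : Continuous (Function.uncurry G) := by
    have : Continuous fun p : ℝ × ℝ => (cos p.1, cos p.2) := by fun_prop
    exact hg.comp_continuous this fun p => ⟨cos_mem_Icc _, cos_mem_Icc _⟩
  have hG1 : ∀ φ, IsEvenPeriodic fun θ => G θ φ := fun φ =>
    isEvenPeriodic_comp_cos (hx _ (cos_mem_Icc φ)).continuousOn
  have hG2 : ∀ θ, IsEvenPeriodic (G θ) := fun θ =>
    isEvenPeriodic_comp_cos (hy _ (cos_mem_Icc θ)).continuousOn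
  set a : ℤ → ℝ → ℝ := fun l θ => ∫ t in -π..π, G θ t * cos (l * t) with ha
  have hac : ∀ l, Continuous (a l) := fun l => by
    refine intervalIntegral.continuous_parametric_intervalIntegral_of_continuous' ?_ _ _
    have : Continuous fun p : ℝ × ℝ => G p.1 p.2 := hGc
    unfold Function.uncurry
    fun_prop
  -- The remainder after approximation in the second variable. No smoothness of `H` in `θ` is known,
  -- so in `θ` only the uniform bound `2 ^ m` for the multiplier remainder is used.
  set H : ℝ → ℝ → ℝ := fun θ φ => G θ φ - cosSum n (fun l => β l * a l θ) φ with hH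
  have hHper : ∀ φ, IsEvenPeriodic fun θ => H θ φ := fun φ =>
    { continuous := by
        have := (hG1 φ).continuous
        simp only [hH, cosSum]
        fun_prop
      even := fun θ => by simp [hH, ha, hG]
      periodic := fun θ => by simp [hH, ha, hG] }
  set B : ℝ := c / ((n : ℝ) + 2) ^ m * (m.factorial * S) with hB
  have hHB : ∀ θ φ, |H θ φ| ≤ B := by
    intro θ φ
    obtain ⟨F, hF0, hF1, hF2, hF3⟩ := (hy _ (cos_mem_Icc θ)).exists_tower_comp_cos hm
    exact (hβ _ (hG2 θ)).2 F _ hF0 hF1 hF2 hF3 φ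
  refine ⟨fun k l => β k * β l * ∫ t in -π..π, a l t * cos (k * t), fun θ φ => ?_⟩
  have h1 : |G θ φ - cosSum n (fun k => β k * ∫ t in -π..π, G t φ * cos (k * t)) θ| ≤ B := by
    obtain ⟨F, hF0, hF1, hF2, hF3⟩ := (hx _ (cos_mem_Icc φ)).exists_tower_comp_cos hm
    exact (hβ _ (hG1 φ)).2 F _ hF0 hF1 hF2 hF3 θ
  have h2 := (hβ _ (hHper φ)).1 B (fun θ => hHB θ φ) θ
  have h3 : cosSum n (fun k => β k * ∫ t in -π..π, H t φ * cos (k * t)) θ =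
      cosSum n (fun k => β k * ∫ t in -π..π, G t φ * cos (k * t)) θ -
        ∑ k ∈ Finset.Icc (-(n : ℤ)) n, ∑ l ∈ Finset.Icc (-(n : ℤ)) n,
          (β k * β l * ∫ t in -π..π, a l t * cos (k * t)) * cos (k * θ) * cos (l * φ) := by
    have hGφ := (hG1 φ).continuous
    simp only [cosSum]
    rw [← Finset.sum_sub_distrib]
    refine Finset.sum_congr rfl fun k _ => ?_
    have e : ∫ t in -π..π, H t φ * cos (k * t) = (∫ t in -π..π, G t φ * cos (k * t)) -
        ∑ l ∈ Finset.Icc (-(n : ℤ)) n,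
          (β l * cos (l * φ)) * ∫ t in -π..π, a l t * cos (k * t) := by
      simp only [← intervalIntegral.integral_const_mul]
      rw [← intervalIntegral.integral_finsetSum
        (fun l _ => by have := hac l; apply Continuous.intervalIntegrable; fun_prop),
        ← intervalIntegral.integral_sub (by apply Continuous.intervalIntegrable; fun_prop)
        (by apply Continuous.intervalIntegrable; fun_prop)]
      congr 1; ext t
      simp only [hH, cosSum, sub_mul, Finset.sum_mul]
      congr 1
      exact Finset.sum_congr rfl fun l _ => by ring
    rw [e, mul_sub, sub_mul, Finset.mul_sum, Finset.sum_mul]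
    congr 1
    exact Finset.sum_congr rfl fun l _ => by ring
  rw [h3] at h2
  have h4 := hHB θ φ
  rw [abs_le] at h1 h2 h4 ⊢
  -- The total error is the `θ`-remainder of `G`, plus `H`, minus the `θ`-remainder of `H`, with
  -- bounds `B`, `B` and `2 ^ m * B`.
  have e : (2 ^ m + 2) * (c * m.factorial) / ((n : ℝ) + 2) ^ m * S = 2 ^ m * B + B + B := by
    rw [hB]; ring
  rw [e]
  constructor <;> linarith [h1.1, h1.2, h2.1, h2.2, h4.1, h4.2]

/-! ### A bias at which many derivatives of the activation are nonzero -/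

theorem exists_polynomial_derivative_eq (q : Polynomial ℝ) :
    ∃ p : Polynomial ℝ, p.derivative = q := by
  induction q using Polynomial.induction_on' with
  | add p q hp hq =>
    obtain ⟨p', rfl⟩ := hp
    obtain ⟨q', rfl⟩ := hq
    exact ⟨p' + q', Polynomial.derivative_add⟩
  | monomial n a =>
    refine ⟨Polynomial.monomial (n + 1) (a / (n + 1)), ?_⟩
    rw [Polynomial.derivative_monomial]
    push_cast
    rw [div_mul_cancel₀ _ (by positivity)]

theorem exists_polynomial_of_iteratedDeriv_eq_zero (k : ℕ) {f : ℝ → ℝ} (hf : ContDiff ℝ ∞ f)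
    (h : ∀ x, iteratedDeriv k f x = 0) : ∃ p : Polynomial ℝ, ∀ x, f x = p.eval x := by
  induction k generalizing f with
  | zero => exact ⟨0, fun x => by simpa using h x⟩
  | succ k ih =>
    have hf' : ContDiff ℝ ∞ (deriv f) := (contDiff_infty_iff_deriv.mp hf).2
    obtain ⟨q, hq⟩ := ih hf' fun x => by rw [← iteratedDeriv_succ']; exact h x
    obtain ⟨p, rfl⟩ := exists_polynomial_derivative_eq q
    have hd : Differentiable ℝ f := (contDiff_infty_iff_deriv.mp hf).1
    have hconst : ∀ x, f x - p.eval x = f 0 - p.eval 0 := by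
      intro x
      refine is_const_of_deriv_eq_zero (f := fun x => f x - p.eval x) (by fun_prop) (fun y => ?_)
        x 0
      rw [deriv_fun_sub (hd y) p.differentiableAt, hq y, Polynomial.deriv, sub_self]
    refine ⟨p + Polynomial.C (f 0 - p.eval 0), fun x => ?_⟩
    rw [Polynomial.eval_add, Polynomial.eval_C, ← hconst x]
    ring

/-- A function that vanishes on an open set has zero derivative there, so nonvanishing of the
derivative allows the open set to be shrunk to one where the function is nonzero too. -/
theorem exists_open_iteratedDeriv_ne_zero (k : ℕ) {f : ℝ → ℝ} (hf : ContDiff ℝ ∞ f) {U : Set ℝ}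
    (hU : IsOpen U) (hne : U.Nonempty) (h : ∀ x ∈ U, iteratedDeriv k f x ≠ 0) :
    ∃ V ⊆ U, IsOpen V ∧ V.Nonempty ∧ ∀ j ≤ k, ∀ x ∈ V, iteratedDeriv j f x ≠ 0 := by
  induction k generalizing f with
  | zero =>
    refine ⟨U, subset_rfl, hU, hne, fun j hj => ?_⟩
    obtain rfl : j = 0 := by omega
    exact h
  | succ k ih =>
    have hf' : ContDiff ℝ ∞ (deriv f) := (contDiff_infty_iff_deriv.mp hf).2
    obtain ⟨V, hVU, hV, hVne, hVd⟩ := ih hf' fun x hx => by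
      rw [← iteratedDeriv_succ']; exact h x hx
    have hx : ∃ x ∈ V, f x ≠ 0 := by
      by_contra! h0
      obtain ⟨x, hxV⟩ := hVne
      refine hVd 0 (Nat.zero_le _) x hxV ?_
      have : f =ᶠ[nhds x] fun _ => 0 := by
        filter_upwards [hV.mem_nhds hxV] with y hy using h0 y hy
      rw [iteratedDeriv_zero, this.deriv_eq]
      simp
    obtain ⟨x, hxV, hx0⟩ := hx
    refine ⟨V ∩ f ⁻¹' {0}ᶜ, Set.inter_subset_left.trans hVU,
      hV.inter (isOpen_compl_singleton.preimage hf.continuous), ⟨x, hxV, hx0⟩, fun j hj y hy => ?_⟩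
    rcases j with _ | j
    · simpa using hy.2
    · rw [iteratedDeriv_succ']
      exact hVd j (by omega) y hy.1

theorem exists_forall_iteratedDeriv_ne_zero {σ : ℝ → ℝ} (hσ : ContDiff ℝ ∞ σ)
    (hpoly : ¬ ∃ p : Polynomial ℝ, ∀ x, σ x = p.eval x) (k : ℕ) :
    ∃ b, ∀ j ≤ k, iteratedDeriv j σ b ≠ 0 := by
  have h : ∃ x, iteratedDeriv k σ x ≠ 0 := by
    by_contra! h
    exact hpoly (exists_polynomial_of_iteratedDeriv_eq_zero k hσ h)
  obtain ⟨x, hx⟩ := h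
  have hc : Continuous (iteratedDeriv k σ) :=
    hσ.continuous_iteratedDeriv k (by exact_mod_cast le_top)
  obtain ⟨V, -, -, ⟨b, hb⟩, hV⟩ := exists_open_iteratedDeriv_ne_zero k hσ
    (isOpen_compl_singleton.preimage hc) ⟨x, hx⟩ fun _ hy => hy
  exact ⟨b, fun j hj => hV j hj b hb⟩

/-! ### Monomials as limits of mixed differences -/

theorem contDiff_fwdDiff {f : ℝ → ℝ} (hf : ContDiff ℝ ∞ f) (u : ℝ) :
    ContDiff ℝ ∞ (fwdDiff u f) := by
  unfold fwdDiff
  exact (hf.comp (contDiff_id.add contDiff_const)).sub hf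

theorem contDiff_fwdDiff_iterate {f : ℝ → ℝ} (hf : ContDiff ℝ ∞ f) (u : ℝ) (a : ℕ) :
    ContDiff ℝ ∞ ((fwdDiff u)^[a] f) := by
  induction a generalizing f with
  | zero => exact hf
  | succ a ih => exact ih (contDiff_fwdDiff hf u)

theorem iteratedDeriv_fwdDiff {f : ℝ → ℝ} (hf : ContDiff ℝ ∞ f) (u : ℝ) (k : ℕ) :
    iteratedDeriv k (fwdDiff u f) = fwdDiff u (iteratedDeriv k f) := by
  ext x
  have h1 : ContDiff ℝ ∞ fun y => f (y + u) := hf.comp (contDiff_id.add contDiff_const)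
  unfold fwdDiff
  have hk : (k : WithTop ℕ∞) ≤ ∞ := by exact_mod_cast le_top
  rw [iteratedDeriv_fun_sub (h1.of_le hk).contDiffAt (hf.of_le hk).contDiffAt,
    iteratedDeriv_comp_add_const]

theorem iteratedDeriv_fwdDiff_iterate {f : ℝ → ℝ} (hf : ContDiff ℝ ∞ f) (u : ℝ) (a k : ℕ) :
    iteratedDeriv k ((fwdDiff u)^[a] f) = (fwdDiff u)^[a] (iteratedDeriv k f) := by
  induction a generalizing f with
  | zero => rfl
  | succ a ih =>
    rw [Function.iterate_succ_apply, Function.iterate_succ_apply, ih (contDiff_fwdDiff hf u),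
      iteratedDeriv_fwdDiff hf]

/-- Mean value theorem for iterated differences. -/
theorem exists_fwdDiff_iterate_eq {f : ℝ → ℝ} (hf : ContDiff ℝ ∞ f) (u b : ℝ) (a : ℕ) :
    ∃ ξ, |ξ - b| ≤ a * |u| ∧ (fwdDiff u)^[a] f b = u ^ a * iteratedDeriv a f ξ := by
  induction a generalizing f with
  | zero => exact ⟨b, by simp, by simp⟩
  | succ a ih =>
    obtain ⟨ξ, hξ, h⟩ := ih (contDiff_fwdDiff hf u)
    rw [iteratedDeriv_fwdDiff hf] at h
    have hd : Differentiable ℝ (iteratedDeriv a f) :=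
      hf.differentiable_iteratedDeriv a (by exact_mod_cast WithTop.coe_lt_top _)
    have hmv : ∃ ζ, |ζ - ξ| ≤ |u| ∧
        iteratedDeriv a f (ξ + u) - iteratedDeriv a f ξ = u * iteratedDeriv (a + 1) f ζ := by
      have hg : ∀ t : ℝ, HasDerivAt (fun t => iteratedDeriv a f (ξ + t * u))
          (iteratedDeriv (a + 1) f (ξ + t * u) * u) t := fun t => by
        have h1 : HasDerivAt (fun t : ℝ => ξ + t * u) u t := by
          simpa using ((hasDerivAt_id t).mul_const u).const_add ξ
        have h2 := (hd (ξ + t * u)).hasDerivAt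
        rw [← iteratedDeriv_succ] at h2
        exact h2.comp t h1
      obtain ⟨t, ht, e⟩ := exists_hasDerivAt_eq_slope _ _ (zero_lt_one (α := ℝ))
        (fun t _ => (hg t).continuousAt.continuousWithinAt) fun t _ => hg t
      refine ⟨ξ + t * u, ?_, ?_⟩
      · rw [add_sub_cancel_left, abs_mul, abs_of_pos ht.1]
        exact mul_le_of_le_one_left (abs_nonneg _) ht.2.le
      · simp only [one_mul, zero_mul, add_zero, sub_zero, div_one] at e
        rw [← e, mul_comm]
    obtain ⟨ζ, hζ, e⟩ := hmv
    refine ⟨ζ, ?_, ?_⟩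
    · calc |ζ - b| = |(ζ - ξ) + (ξ - b)| := by ring_nf
        _ ≤ |ζ - ξ| + |ξ - b| := abs_add_le _ _
        _ ≤ _ := by push_cast; linarith
    · rw [Function.iterate_succ_apply, h, fwdDiff, e]
      ring

/-- With `u = h * x` and `v = h * y` this isolates `x ^ a * y ^ c`, and the bound on `ξ` is uniform
for `x`, `y` in `[-1, 1]`. -/
theorem exists_mixed_fwdDiff_eq {f : ℝ → ℝ} (hf : ContDiff ℝ ∞ f) (u v b : ℝ) (a c : ℕ) :
    ∃ ξ, |ξ - b| ≤ a * |u| + c * |v| ∧ (fwdDiff u)^[a] ((fwdDiff v)^[c] f) b =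
      u ^ a * v ^ c * iteratedDeriv (a + c) f ξ := by
  obtain ⟨ζ, hζ, h⟩ := exists_fwdDiff_iterate_eq (contDiff_fwdDiff_iterate hf v c) u b a
  rw [iteratedDeriv_fwdDiff_iterate hf] at h
  have hfa : ContDiff ℝ ∞ (iteratedDeriv a f) := by
    rw [iteratedDeriv_eq_iterate]
    exact hf.iterate_deriv a
  obtain ⟨ξ, hξ, h'⟩ := exists_fwdDiff_iterate_eq hfa v ζ c
  refine ⟨ξ, ?_, ?_⟩
  · calc |ξ - b| = |(ζ - b) + (ξ - ζ)| := by ring_nf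
      _ ≤ |ζ - b| + |ξ - ζ| := abs_add_le _ _
      _ ≤ _ := by linarith
  · rw [h, h', iteratedDeriv_eq_iterate, iteratedDeriv_eq_iterate, iteratedDeriv_eq_iterate,
      ← Function.iterate_add_apply, mul_assoc, add_comm c a]

/-- The span of the units with weights on the grid `h • {0, …, n}²` and common bias `b`. -/
def gridSpan (σ : ℝ → ℝ) (b h : ℝ) (n : ℕ) : Submodule ℝ (ℝ → ℝ → ℝ) :=
  Submodule.span ℝ (Set.range fun p : Fin (n + 1) × Fin (n + 1) =>
    fun x y => σ (b + (p.1 : ℕ) • (h * x) + (p.2 : ℕ) • (h * y)))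

/-- The binomial expansion of a mixed difference only evaluates `σ` at shifts by grid multiples of
`h * x` and `h * y`. -/
theorem mixed_fwdDiff_mem_gridSpan (σ : ℝ → ℝ) (b h : ℝ) {n a c : ℕ} (ha : a ≤ n) (hc : c ≤ n) :
    (fun x y => (fwdDiff (h * x))^[a] ((fwdDiff (h * y))^[c] σ) b) ∈ gridSpan σ b h n := by
  have e : (fun x y => (fwdDiff (h * x))^[a] ((fwdDiff (h * y))^[c] σ) b) =
      ∑ i ∈ range (a + 1), ((-1 : ℤ) ^ (a - i) * (a.choose i : ℤ)) •
        ∑ l ∈ range (c + 1), ((-1 : ℤ) ^ (c - l) * (c.choose l : ℤ)) •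
          (fun x y => σ (b + i • (h * x) + l • (h * y)) : ℝ → ℝ → ℝ) := by
    ext x y
    simp only [fwdDiff_iter_eq_sum_shift, Finset.sum_apply, Pi.smul_apply]
  rw [e]
  refine Submodule.sum_mem _ fun i hi => zsmul_mem (Submodule.sum_mem _ fun l hl =>
    zsmul_mem (Submodule.subset_span ?_) _) _
  have hi' := Finset.mem_range.mp hi
  have hl' := Finset.mem_range.mp hl
  exact ⟨(⟨i, by omega⟩, ⟨l, by omega⟩), rfl⟩

theorem exists_shallow_of_mem_gridSpan {σ : ℝ → ℝ} {b h : ℝ} {n : ℕ} {f : ℝ → ℝ → ℝ}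
    (hf : f ∈ gridSpan σ b h n) :
    ∃ P ∈ shallow σ ((n + 1) ^ 2) 2, ∀ x, P x = f (x 0) (x 1) := by
  obtain ⟨c, rfl⟩ := (Submodule.mem_span_range_iff_exists_fun ℝ).mp hf
  let e : Fin ((n + 1) ^ 2) ≃ Fin (n + 1) × Fin (n + 1) :=
    (finCongr (sq (n + 1))).trans finProdFinEquiv.symm
  refine ⟨_, ⟨fun k => c (e k), fun _ => b,
    fun k => ![((e k).1 : ℕ) * h, ((e k).2 : ℕ) * h], rfl⟩, fun x => ?_⟩
  simp only [Finset.sum_apply, Pi.smul_apply, smul_eq_mul, Fin.sum_univ_two, nsmul_eq_mul,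
    Matrix.cons_val_zero, Matrix.cons_val_one]
  rw [← e.sum_comp]
  refine Finset.sum_congr rfl fun k _ => ?_
  congr 2
  ring

/-- Polynomials of coordinate degrees at most `n` are uniform limits of shallow networks with
`(n + 1) ^ 2` units. -/
theorem exists_shallow_near_polynomial {σ : ℝ → ℝ} (hσ : ContDiff ℝ ∞ σ)
    (hpoly : ¬ ∃ p : Polynomial ℝ, ∀ x, σ x = p.eval x) (n : ℕ) (w : ℕ → ℕ → ℝ) {η : ℝ}
    (hη : 0 < η) : ∃ P ∈ shallow σ ((n + 1) ^ 2) 2,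
      ∀ x ∈ Set.Icc (-1 : ℝ) 1, ∀ y ∈ Set.Icc (-1 : ℝ) 1,
        |∑ a ∈ range (n + 1), ∑ c ∈ range (n + 1), w a c * (x ^ a * y ^ c) - P ![x, y]| ≤ η := by
  -- The monomials involve the orders `a + c ≤ 2 * n`.
  obtain ⟨b, hb⟩ := exists_forall_iteratedDeriv_ne_zero hσ hpoly (2 * n)
  set W : ℝ := ∑ a ∈ range (n + 1), ∑ c ∈ range (n + 1),
    |w a c / iteratedDeriv (a + c) σ b| with hW
  have hW0 : 0 ≤ W := by positivity
  have hnear : ∃ δ > 0, ∀ j ≤ 2 * n, ∀ ξ, |ξ - b| < δ →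
      |iteratedDeriv j σ b - iteratedDeriv j σ ξ| ≤ η / (W + 1) := by
    have : ∀ᶠ ξ in nhds b, ∀ j ∈ range (2 * n + 1),
        |iteratedDeriv j σ b - iteratedDeriv j σ ξ| < η / (W + 1) := by
      rw [Filter.eventually_all_finset]
      intro j _
      have hc : Continuous (iteratedDeriv j σ) :=
        hσ.continuous_iteratedDeriv j (by exact_mod_cast le_top)
      have hc' : Continuous fun ξ => |iteratedDeriv j σ b - iteratedDeriv j σ ξ| := by fun_prop
      exact hc'.continuousAt.eventually_lt continuousAt_const (by simpa using by positivity)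
    obtain ⟨δ, hδ, h⟩ := Metric.eventually_nhds_iff.mp this
    exact ⟨δ, hδ, fun j hj ξ hξ => (h hξ j (Finset.mem_range.mpr (by omega))).le⟩
  obtain ⟨δ, hδ, hnear⟩ := hnear
  -- Every intermediate point lies within `2 * n * h < δ` of `b`; the `+ 1` covers `n = 0`.
  set h : ℝ := δ / (2 * n + 1) with hh
  have hpos : 0 < h := by positivity
  have hsmall : 2 * n * h < δ := by
    rw [hh, ← mul_div_assoc, div_lt_iff₀ (by positivity)]
    linarith
  obtain ⟨P, hP, hPf⟩ := exists_shallow_of_mem_gridSpan (σ := σ) (b := b) (h := h) (n := n)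
    (f := ∑ a ∈ range (n + 1), ∑ c ∈ range (n + 1),
      (w a c / (iteratedDeriv (a + c) σ b * (h ^ a * h ^ c))) •
        fun x y => (fwdDiff (h * x))^[a] ((fwdDiff (h * y))^[c] σ) b)
    (Submodule.sum_mem _ fun a ha => Submodule.sum_mem _ fun c hc => Submodule.smul_mem _ _
      (mixed_fwdDiff_mem_gridSpan σ b h (Nat.lt_succ_iff.mp (Finset.mem_range.mp ha))
        (Nat.lt_succ_iff.mp (Finset.mem_range.mp hc))))
  refine ⟨P, hP, fun x hx y hy => ?_⟩
  rw [hPf]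
  simp only [Finset.sum_apply, Pi.smul_apply, smul_eq_mul, Matrix.cons_val_zero,
    Matrix.cons_val_one, ← Finset.sum_sub_distrib]
  have hx1 : |x| ≤ 1 := abs_le.mpr hx
  have hy1 : |y| ≤ 1 := abs_le.mpr hy
  have hterm : ∀ a ∈ range (n + 1), ∀ c ∈ range (n + 1),
      |w a c * (x ^ a * y ^ c) - w a c / (iteratedDeriv (a + c) σ b * (h ^ a * h ^ c)) *
        (fwdDiff (h * x))^[a] ((fwdDiff (h * y))^[c] σ) b| ≤
      |w a c / iteratedDeriv (a + c) σ b| * (η / (W + 1)) := by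
    intro a ha c hc
    have ha' : a ≤ n := Nat.lt_succ_iff.mp (Finset.mem_range.mp ha)
    have hc' : c ≤ n := Nat.lt_succ_iff.mp (Finset.mem_range.mp hc)
    obtain ⟨ξ, hξ, e⟩ := exists_mixed_fwdDiff_eq hσ (h * x) (h * y) b a c
    have hbj := hb (a + c) (by omega)
    rw [e]
    have e2 : w a c * (x ^ a * y ^ c) - w a c / (iteratedDeriv (a + c) σ b * (h ^ a * h ^ c)) *
        ((h * x) ^ a * (h * y) ^ c * iteratedDeriv (a + c) σ ξ) =
        w a c / iteratedDeriv (a + c) σ b * ((x ^ a * y ^ c) *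
          (iteratedDeriv (a + c) σ b - iteratedDeriv (a + c) σ ξ)) := by
      rw [mul_pow, mul_pow]
      field_simp
    rw [e2, abs_mul]
    refine mul_le_mul_of_nonneg_left ?_ (abs_nonneg _)
    have h1 : |x ^ a * y ^ c| ≤ 1 := by
      rw [abs_mul, abs_pow, abs_pow]
      exact mul_le_one₀ (pow_le_one₀ (abs_nonneg _) hx1) (by positivity)
        (pow_le_one₀ (abs_nonneg _) hy1)
    have h2 : |ξ - b| < δ := by
      have h3 : |h * x| ≤ h := by
        rw [abs_mul, abs_of_pos hpos]; exact mul_le_of_le_one_right hpos.le hx1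
      have h4 : |h * y| ≤ h := by
        rw [abs_mul, abs_of_pos hpos]; exact mul_le_of_le_one_right hpos.le hy1
      calc |ξ - b| ≤ a * |h * x| + c * |h * y| := hξ
        _ ≤ n * h + n * h := by gcongr
        _ < δ := by linarith
    rw [abs_mul]
    calc _ ≤ 1 * |iteratedDeriv (a + c) σ b - iteratedDeriv (a + c) σ ξ| :=
          mul_le_mul_of_nonneg_right h1 (abs_nonneg _)
      _ ≤ _ := by rw [one_mul]; exact hnear _ (by omega) ξ h2
  calc _ ≤ ∑ a ∈ range (n + 1), ∑ c ∈ range (n + 1),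
        |w a c / iteratedDeriv (a + c) σ b| * (η / (W + 1)) := by
        refine (Finset.abs_sum_le_sum_abs _ _).trans (Finset.sum_le_sum fun a ha => ?_)
        exact (Finset.abs_sum_le_sum_abs _ _).trans (Finset.sum_le_sum (hterm a ha))
    _ = W * (η / (W + 1)) := by simp only [hW, Finset.sum_mul]
    _ ≤ η := by
        rw [← mul_div_assoc, div_le_iff₀ (by positivity)]
        nlinarith

/-! ### Shallow approximation of smooth functions on the square -/

theorem SmoothBy.abs_sub_le {m : ℕ} (hm : 1 ≤ m) {S : ℝ} {u : ℝ → ℝ} (h : SmoothBy m S u)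
    {x y : ℝ} (hx : x ∈ Set.Icc (-1 : ℝ) 1) (hy : y ∈ Set.Icc (-1 : ℝ) 1) :
    |u x - u y| ≤ S * |x - y| := by
  obtain ⟨p, rfl, hp, -, hS⟩ := h
  exact (convex_Icc (-1 : ℝ) 1).norm_image_sub_le_of_norm_hasDerivWithin_le
    (f := p 0) (f' := p 1) (hp 0 hm) (hS 1 le_rfl hm) hy hx

theorem SmoothBy.nonneg {m : ℕ} (hm : 1 ≤ m) {S : ℝ} {u : ℝ → ℝ} (h : SmoothBy m S u) :
    0 ≤ S := by
  simpa using (abs_nonneg _).trans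
    (h.abs_sub_le hm (x := 1) (y := 0) (by norm_num) (by norm_num))

theorem exists_shallow_eq_const {σ : ℝ → ℝ} {b : ℝ} (hb : σ b ≠ 0) {M d : ℕ} (hM : 0 < M)
    (c : ℝ) : (fun _ => c) ∈ shallow σ M d := by
  refine ⟨fun _ => c / (M * σ b), fun _ => b, fun _ _ => 0, ?_⟩
  have : (M : ℝ) ≠ 0 := by exact_mod_cast hM.ne'
  ext x
  simp only [zero_mul, Finset.sum_const_zero, zero_add, Finset.sum_const, Finset.card_univ,
    Fintype.card_fin, nsmul_eq_mul]
  field_simp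

/-- Since `cos (k * θ) = T_k (cos θ)` and `T_k` has degree `|k|`, the trigonometric approximant is a
polynomial of coordinate degrees at most `n`. -/
theorem sum_chebyshev_eq (n : ℕ) (γ : ℤ → ℤ → ℝ) (x y : ℝ) :
    ∑ k ∈ Finset.Icc (-(n : ℤ)) n, ∑ l ∈ Finset.Icc (-(n : ℤ)) n,
      γ k l * (Polynomial.Chebyshev.T ℝ k).eval x * (Polynomial.Chebyshev.T ℝ l).eval y =
    ∑ a ∈ range (n + 1), ∑ c ∈ range (n + 1),
      (∑ k ∈ Finset.Icc (-(n : ℤ)) n, ∑ l ∈ Finset.Icc (-(n : ℤ)) n, γ k l *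
        (Polynomial.Chebyshev.T ℝ k).coeff a * (Polynomial.Chebyshev.T ℝ l).coeff c) *
        (x ^ a * y ^ c) := by
  have hT : ∀ k ∈ Finset.Icc (-(n : ℤ)) n, ∀ z : ℝ, (Polynomial.Chebyshev.T ℝ k).eval z =
      ∑ a ∈ range (n + 1), (Polynomial.Chebyshev.T ℝ k).coeff a * z ^ a := by
    intro k hk z
    apply Polynomial.eval_eq_sum_range'
    rw [Polynomial.Chebyshev.natDegree_T]
    have := Finset.mem_Icc.mp hk
    omega
  have h1 : ∀ k ∈ Finset.Icc (-(n : ℤ)) n, ∀ l ∈ Finset.Icc (-(n : ℤ)) n,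
      γ k l * (Polynomial.Chebyshev.T ℝ k).eval x * (Polynomial.Chebyshev.T ℝ l).eval y =
      ∑ a ∈ range (n + 1), ∑ c ∈ range (n + 1), γ k l *
        (Polynomial.Chebyshev.T ℝ k).coeff a * (Polynomial.Chebyshev.T ℝ l).coeff c *
        (x ^ a * y ^ c) := by
    intro k hk l hl
    rw [hT k hk, hT l hl, mul_assoc, Finset.sum_mul_sum, Finset.mul_sum]
    refine Finset.sum_congr rfl fun a _ => ?_
    rw [Finset.mul_sum]
    exact Finset.sum_congr rfl fun c _ => by ring
  rw [Finset.sum_congr rfl fun k hk => Finset.sum_congr rfl fun l hl => h1 k hk l hl]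
  simp only [Finset.sum_mul]
  rw [Finset.sum_congr rfl fun k _ => Finset.sum_comm, Finset.sum_comm]
  refine Finset.sum_congr rfl fun a _ => ?_
  rw [Finset.sum_congr rfl fun k _ => Finset.sum_comm, Finset.sum_comm]

/-- Shallow networks with `(n + 1) ^ 2` units approximate smooth bivariate functions to order
`n ^ (-m)`. -/
theorem exists_shallow_near_smooth {m : ℕ} (hm : 1 ≤ m) {σ : ℝ → ℝ} (hσ : ContDiff ℝ ∞ σ)
    (hpoly : ¬ ∃ p : Polynomial ℝ, ∀ x, σ x = p.eval x) : ∃ C : ℝ, 0 < C ∧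
    ∀ (n : ℕ) (g : ℝ → ℝ → ℝ) (S : ℝ),
      ContinuousOn (Function.uncurry g) (Set.Icc (-1) 1 ×ˢ Set.Icc (-1) 1) →
      (∀ y ∈ Set.Icc (-1 : ℝ) 1, SmoothBy m S fun x => g x y) →
      (∀ x ∈ Set.Icc (-1 : ℝ) 1, SmoothBy m S (g x)) →
      ∃ P ∈ shallow σ ((n + 1) ^ 2) 2, ∀ x ∈ Set.Icc (-1 : ℝ) 1, ∀ y ∈ Set.Icc (-1 : ℝ) 1,
        |g x y - P ![x, y]| ≤ C / ((n : ℝ) + 2) ^ m * S := by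
  obtain ⟨C, hC, hjack⟩ := exists_bivariate_jackson m hm
  refine ⟨C + 1, by positivity, fun n g S hg hx hy => ?_⟩
  have h0 : (0 : ℝ) ∈ Set.Icc (-1 : ℝ) 1 := by norm_num
  have hS : 0 ≤ S := (hx 0 h0).nonneg hm
  -- For `S = 0` the tolerance is zero and no limit argument is possible, but then `g` is constant
  -- on the square and is matched exactly.
  rcases hS.eq_or_lt with rfl | hS
  · obtain ⟨b, hb⟩ := exists_forall_iteratedDeriv_ne_zero hσ hpoly 0
    refine ⟨_, exists_shallow_eq_const (b := b) (by simpa using hb 0 le_rfl) (by positivity)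
      (g 0 0), fun x hx' y hy' => ?_⟩
    have h1 := (hx y hy').abs_sub_le hm hx' h0
    have h2 := (hy 0 h0).abs_sub_le hm hy' h0
    rw [zero_mul] at h1 h2
    rw [mul_zero, abs_nonpos_iff, sub_eq_zero]
    rw [abs_nonpos_iff, sub_eq_zero] at h1 h2
    rw [h1, h2]
  · obtain ⟨γ, hγ⟩ := hjack n g S hg hx hy
    obtain ⟨P, hP, hPγ⟩ := exists_shallow_near_polynomial hσ hpoly n
      (fun a c => ∑ k ∈ Finset.Icc (-(n : ℤ)) n, ∑ l ∈ Finset.Icc (-(n : ℤ)) n, γ k l *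
        (Polynomial.Chebyshev.T ℝ k).coeff a * (Polynomial.Chebyshev.T ℝ l).coeff c)
      (η := S / ((n : ℝ) + 2) ^ m) (by positivity)
    refine ⟨P, hP, fun x hx' y hy' => ?_⟩
    have h1 := hPγ x hx' y hy'
    have h2 := hγ (arccos x) (arccos y)
    simp only [← Polynomial.Chebyshev.T_real_cos, cos_arccos hx'.1 hx'.2,
      cos_arccos hy'.1 hy'.2] at h2
    rw [sum_chebyshev_eq] at h2
    refine (abs_sub_le _ _ _).trans ((add_le_add h2 h1).trans (le_of_eq ?_))
    ring

/-! ### Partial derivatives and slices on the cube -/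

theorem cube_eq_pi (d : ℕ) : cube d = Set.univ.pi fun _ => Set.Icc (-1 : ℝ) 1 := by
  ext x; simp only [cube, Set.mem_ofPred_eq, Set.mem_univ_pi]

theorem uniqueDiffOn_cube (d : ℕ) : UniqueDiffOn ℝ (cube d) := by
  rw [cube_eq_pi]
  exact UniqueDiffOn.univ_pi fun _ => uniqueDiffOn_Icc_neg_one_one

theorem isCompact_cube (d : ℕ) : IsCompact (cube d) := by
  rw [cube_eq_pi]
  exact isCompact_univ_pi fun _ => isCompact_Icc

theorem update_mem_cube {d : ℕ} {x : Fin d → ℝ} (hx : x ∈ cube d) (i : Fin d) {s : ℝ}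
    (hs : s ∈ Set.Icc (-1 : ℝ) 1) : Function.update x i s ∈ cube d := by
  intro j
  rcases eq_or_ne j i with rfl | h
  · rwa [Function.update_self]
  · rw [Function.update_of_ne h]
    exact hx j

theorem supNorm_nonneg {d : ℕ} (g : (Fin d → ℝ) → ℝ) : 0 ≤ supNorm g :=
  Real.iSup_nonneg fun _ => abs_nonneg _

theorem abs_le_supNorm {d : ℕ} {g : (Fin d → ℝ) → ℝ} (hg : ContinuousOn g (cube d))
    {x : Fin d → ℝ} (hx : x ∈ cube d) : |g x| ≤ supNorm g := by
  obtain ⟨B, hB⟩ := (isCompact_cube d).exists_bound_of_continuousOn hg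
  refine le_ciSup (f := fun x : cube d => |g x|) ⟨B, ?_⟩ (⟨x, hx⟩ : cube d)
  rintro _ ⟨y, rfl⟩
  exact hB y y.2

theorem hasDerivWithinAt_slice {d : ℕ} {g : (Fin d → ℝ) → ℝ} (hg : DifferentiableOn ℝ g (cube d))
    (i : Fin d) {x : Fin d → ℝ} (hx : x ∈ cube d) :
    HasDerivWithinAt (fun s => g (Function.update x i s))
      (fderivWithin ℝ g (cube d) x (Pi.single i 1)) (Set.Icc (-1) 1) (x i) := by
  have h1 : HasFDerivWithinAt g (fderivWithin ℝ g (cube d) x) (cube d)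
      (Function.update x i (x i)) := by
    rw [Function.update_eq_self]
    exact (hg x hx).hasFDerivWithinAt
  exact h1.comp_hasDerivWithinAt (x i) (hasDerivAt_update x i (x i)).hasDerivWithinAt
    fun s hs => update_mem_cube hx i hs

theorem partialDeriv_eq_fderivWithin {d : ℕ} {g : (Fin d → ℝ) → ℝ}
    (hg : DifferentiableOn ℝ g (cube d)) (i : Fin d) {x : Fin d → ℝ} (hx : x ∈ cube d) :
    partialDeriv i g x = fderivWithin ℝ g (cube d) x (Pi.single i 1) :=
  (hasDerivWithinAt_slice hg i hx).derivWithin (uniqueDiffOn_Icc_neg_one_one _ (hx i))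

theorem contDiffOn_partialDeriv {d k : ℕ} {g : (Fin d → ℝ) → ℝ}
    (hg : ContDiffOn ℝ (k + 1 : ℕ) g (cube d)) (i : Fin d) :
    ContDiffOn ℝ k (partialDeriv i g) (cube d) := by
  have h1 : ContDiffOn ℝ k (fderivWithin ℝ g (cube d)) (cube d) :=
    hg.fderivWithin (uniqueDiffOn_cube d) (by norm_cast)
  refine (h1.clm_apply contDiffOn_const).congr fun x hx =>
    partialDeriv_eq_fderivWithin (hg.differentiableOn (by simp)) i hx

theorem contDiffOn_partialDeriv_iterate {d m : ℕ} {g : (Fin d → ℝ) → ℝ}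
    (hg : ContDiffOn ℝ m g (cube d)) (i : Fin d) {j : ℕ} (hj : j ≤ m) :
    ContDiffOn ℝ (m - j : ℕ) ((partialDeriv i)^[j] g) (cube d) := by
  induction j with
  | zero => exact hg
  | succ j ih =>
    rw [Function.iterate_succ_apply']
    apply contDiffOn_partialDeriv
    rw [show m - (j + 1) + 1 = m - j by omega]
    exact ih (by omega)

theorem mul_mem_Icc_neg_one_one {ρ x : ℝ} (hρ : ρ ∈ Set.Icc (0 : ℝ) 1)
    (hx : x ∈ Set.Icc (-1 : ℝ) 1) : ρ * x ∈ Set.Icc (-1 : ℝ) 1 := by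
  rw [Set.mem_Icc, ← abs_le] at hx ⊢
  rw [abs_mul, abs_of_nonneg hρ.1]
  exact mul_le_one₀ hρ.2 (abs_nonneg _) hx

/-- The chain rule gives the `j`-th derivative of the rescaled slice a factor `ρ ^ j`; the scaling
of errors with the rectangle comes from here. -/
theorem smoothBy_slice {d m : ℕ} {h : (Fin d → ℝ) → ℝ} (hh : ContDiffOn ℝ m h (cube d))
    (i : Fin d) {z : Fin d → ℝ} (hz : z ∈ cube d) {ρ S : ℝ} (hρ : ρ ∈ Set.Icc (0 : ℝ) 1)
    (hS : ∀ j ∈ Finset.Icc 1 m, ρ ^ j * supNorm ((partialDeriv i)^[j] h) ≤ S) :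
    SmoothBy m S fun s => h (Function.update z i (ρ * s)) := by
  have hmaps : Set.MapsTo (fun s => ρ * s) (Set.Icc (-1 : ℝ) 1) (Set.Icc (-1) 1) :=
    fun s hs => mul_mem_Icc_neg_one_one hρ hs
  refine ⟨fun j s => ρ ^ j * (partialDeriv i)^[j] h (Function.update z i (ρ * s)), ?_, ?_, ?_, ?_⟩
  · ext s; simp
  · intro j hj s hs
    have hd : DifferentiableOn ℝ ((partialDeriv i)^[j] h) (cube d) :=
      (contDiffOn_partialDeriv_iterate hh i hj.le).differentiableOn (by
        norm_cast; omega)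
    have hz' := update_mem_cube hz i (hmaps hs)
    have h1 := hasDerivWithinAt_slice hd i hz'
    rw [← partialDeriv_eq_fderivWithin hd i hz'] at h1
    simp only [Function.update_idem, Function.update_self] at h1
    have h2 : HasDerivWithinAt (fun s : ℝ => ρ * s) ρ (Set.Icc (-1) 1) s := by
      simpa using ((hasDerivAt_id s).const_mul ρ).hasDerivWithinAt
    have h3 := (HasDerivWithinAt.comp s h1 h2 hmaps).const_mul (ρ ^ j)
    simp only [Function.iterate_succ_apply', pow_succ]
    exact h3.congr_deriv (by ring)
  · refine continuousOn_const.mul ?_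
    refine (contDiffOn_partialDeriv_iterate hh i le_rfl).continuousOn.comp
      (Continuous.continuousOn (by fun_prop)) fun s hs => update_mem_cube hz i (hmaps hs)
  · intro j h1 hj s hs
    rw [abs_mul, abs_of_nonneg (pow_nonneg hρ.1 j)]
    exact (mul_le_mul_of_nonneg_left (abs_le_supNorm
      (contDiffOn_partialDeriv_iterate hh i hj).continuousOn
      (update_mem_cube hz i (hmaps hs))) (pow_nonneg hρ.1 j)).trans
      (hS j (Finset.mem_Icc.mpr ⟨h1, hj⟩))

theorem mem_cube_two {x y : ℝ} (hx : x ∈ Set.Icc (-1 : ℝ) 1) (hy : y ∈ Set.Icc (-1 : ℝ) 1) :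
    ![x, y] ∈ cube 2 := by
  intro i; fin_cases i <;> assumption

theorem update_vec_zero (x y s : ℝ) : Function.update ![x, y] 0 s = ![s, y] := by
  ext i; fin_cases i <;> simp

theorem update_vec_one (x y s : ℝ) : Function.update ![x, y] 1 s = ![x, s] := by
  ext i; fin_cases i <;> simp

/-- The norms of the pure partial derivatives are part of the Sobolev-type norm. -/
theorem supNorm_add_sum_le_one {m : ℕ} {h : (Fin 2 → ℝ) → ℝ} (hh : h ∈ smoothClass m 2) :
    supNorm h + ∑ j ∈ Finset.Icc 1 m, (supNorm ((partialDeriv 0)^[j] h) +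
      supNorm ((partialDeriv 1)^[j] h)) ≤ 1 := by
  refine le_trans (add_le_add le_rfl (Finset.sum_le_sum fun j hj => ?_)) hh.2
  have hj1 := (Finset.mem_Icc.mp hj).1
  have e0 : multiDeriv ![j, 0] h = (partialDeriv 0)^[j] h := by
    simp [multiDeriv, List.finRange_succ]
  have e1 : multiDeriv ![0, j] h = (partialDeriv 1)^[j] h := by
    simp [multiDeriv, List.finRange_succ]
  rw [← e0, ← e1]
  -- The two pure multi-indices are distinct because `j ≥ 1`, so both norms are counted in the sum.
  have hne : (![j, 0] : Fin 2 → ℕ) ≠ ![0, j] := fun e => by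
    have := congrFun e 0
    simp at this
    omega
  rw [← Finset.sum_pair (f := fun k => supNorm (multiDeriv k h)) hne]
  refine Finset.sum_le_sum_of_subset_of_nonneg (fun k hk => ?_) fun _ _ _ => supNorm_nonneg _
  rw [Finset.mem_piAntidiag]
  simp only [Finset.mem_insert, Finset.mem_singleton] at hk
  rcases hk with rfl | rfl <;> simp

/-- One coordinate is changed at a time, through the point `(u', v)`. -/
theorem abs_sub_le_of_mem_smoothClass {m : ℕ} (hm : 1 ≤ m) {h : (Fin 2 → ℝ) → ℝ}
    (hh : h ∈ smoothClass m 2) {u v u' v' : ℝ} (hu : u ∈ Set.Icc (-1 : ℝ) 1)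
    (hv : v ∈ Set.Icc (-1 : ℝ) 1) (hu' : u' ∈ Set.Icc (-1 : ℝ) 1)
    (hv' : v' ∈ Set.Icc (-1 : ℝ) 1) :
    |h ![u, v] - h ![u', v']| ≤
      supNorm (partialDeriv 0 h) * |u - u'| + supNorm (partialDeriv 1 h) * |v - v'| := by
  have hd : ContDiffOn ℝ 1 h (cube 2) := hh.1.of_le (by exact_mod_cast hm)
  have hS : ∀ i : Fin 2, ∀ j ∈ Finset.Icc 1 1,
      (1 : ℝ) ^ j * supNorm ((partialDeriv i)^[j] h) ≤ supNorm (partialDeriv i h) := by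
    intro i j hj
    obtain rfl : j = 1 := by simpa using hj
    simp
  have h1 := (smoothBy_slice (m := 1) (by exact_mod_cast hd) 0 (mem_cube_two hu hv)
    (ρ := 1) (by simp) (hS 0)).abs_sub_le le_rfl hu hu'
  have h2 := (smoothBy_slice (m := 1) (by exact_mod_cast hd) 1 (mem_cube_two hu' hv)
    (ρ := 1) (by simp) (hS 1)).abs_sub_le le_rfl hv hv'
  simp only [one_mul, update_vec_zero, update_vec_one] at h1 h2
  exact (abs_sub_le _ _ _).trans (add_le_add h1 h2)

/-! ### Approximation on rectangles -/

/-- Approximation of a constituent function on a rectangle, with an error that scales with the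
rectangle. -/
theorem exists_shallow_near_on_rectangle {m : ℕ} (hm : 1 ≤ m) {σ : ℝ → ℝ} (hσ : ContDiff ℝ ∞ σ)
    (hpoly : ¬ ∃ p : Polynomial ℝ, ∀ x, σ x = p.eval x) : ∃ C : ℝ, 0 < C ∧
    ∀ (n : ℕ), ∀ h ∈ smoothClass m 2, ∀ ρ ∈ Set.Icc (0 : ℝ) 1, ∀ τ ∈ Set.Icc (0 : ℝ) 1,
      ∃ P ∈ shallow σ ((n + 1) ^ 2) 2, ∀ x y : ℝ, |x| ≤ ρ → |y| ≤ τ →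
        |h ![x, y] - P ![x, y]| ≤ C / ((n : ℝ) + 2) ^ m * ∑ j ∈ Finset.Icc 1 m,
          (ρ ^ j * supNorm ((partialDeriv 0)^[j] h) + τ ^ j * supNorm ((partialDeriv 1)^[j] h)) := by
  obtain ⟨C, hC, hnet⟩ := exists_shallow_near_smooth hm hσ hpoly
  refine ⟨C, hC, fun n h hh ρ hρ τ hτ => ?_⟩
  set S : ℝ := ∑ j ∈ Finset.Icc 1 m,
    (ρ ^ j * supNorm ((partialDeriv 0)^[j] h) + τ ^ j * supNorm ((partialDeriv 1)^[j] h)) with hS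
  have n0 : ∀ j, 0 ≤ ρ ^ j * supNorm ((partialDeriv 0)^[j] h) := fun j =>
    mul_nonneg (pow_nonneg hρ.1 j) (supNorm_nonneg _)
  have n1 : ∀ j, 0 ≤ τ ^ j * supNorm ((partialDeriv 1)^[j] h) := fun j =>
    mul_nonneg (pow_nonneg hτ.1 j) (supNorm_nonneg _)
  have hle : ∀ j ∈ Finset.Icc 1 m, ρ ^ j * supNorm ((partialDeriv 0)^[j] h) +
      τ ^ j * supNorm ((partialDeriv 1)^[j] h) ≤ S := fun j hj =>
    Finset.single_le_sum (f := fun j => ρ ^ j * supNorm ((partialDeriv 0)^[j] h) +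
      τ ^ j * supNorm ((partialDeriv 1)^[j] h)) (fun j _ => add_nonneg (n0 j) (n1 j)) hj
  have hg0 : ContinuousOn (Function.uncurry fun x y => h ![ρ * x, τ * y])
      (Set.Icc (-1) 1 ×ˢ Set.Icc (-1) 1) := by
    have hc : Continuous fun p : ℝ × ℝ => ![ρ * p.1, τ * p.2] := by fun_prop
    exact hh.1.continuousOn.comp hc.continuousOn fun p hp =>
      mem_cube_two (mul_mem_Icc_neg_one_one hρ hp.1) (mul_mem_Icc_neg_one_one hτ hp.2)
  have hg1 : ∀ y ∈ Set.Icc (-1 : ℝ) 1, SmoothBy m S fun x => h ![ρ * x, τ * y] := by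
    intro y hy
    have := smoothBy_slice hh.1 0 (mem_cube_two (x := 0) (by norm_num)
      (mul_mem_Icc_neg_one_one hτ hy)) hρ (S := S) fun j hj => by
        linarith [hle j hj, n1 j]
    simpa only [update_vec_zero] using this
  have hg2 : ∀ x ∈ Set.Icc (-1 : ℝ) 1, SmoothBy m S fun y => h ![ρ * x, τ * y] := by
    intro x hx
    have := smoothBy_slice hh.1 1 (mem_cube_two (y := 0) (mul_mem_Icc_neg_one_one hρ hx)
      (by norm_num)) hτ (S := S) fun j hj => by
        linarith [hle j hj, n0 j]
    simpa only [update_vec_one] using this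
  obtain ⟨P, ⟨a, b, w, rfl⟩, hP⟩ := hnet n (fun x y => h ![ρ * x, τ * y]) S hg0 hg1 hg2
  -- Dividing the weights by the radii undoes the rescaling. A zero radius forces the coordinate to
  -- be `0`, which agrees with division by zero giving `0`.
  refine ⟨_, ⟨a, b, fun k => ![w k 0 / ρ, w k 1 / τ], rfl⟩, fun x y hx hy => ?_⟩
  have key : ∀ {r s : ℝ}, |s| ≤ r → s / r ∈ Set.Icc (-1 : ℝ) 1 ∧ r * (s / r) = s := by
    intro r s hs
    have hr : 0 ≤ r := (abs_nonneg s).trans hs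
    refine ⟨?_, ?_⟩
    · rw [Set.mem_Icc, ← abs_le, abs_div, abs_of_nonneg hr]
      exact div_le_one_of_le₀ hs hr
    · rcases hr.eq_or_lt with rfl | hr
      · rw [zero_mul, abs_nonpos_iff.mp hs]
      · field_simp
  have := hP (x / ρ) (key hx).1 (y / τ) (key hy).1
  simp only [(key hx).2, (key hy).2, Fin.sum_univ_two, Matrix.cons_val_zero,
    Matrix.cons_val_one] at this ⊢
  have hw : ∀ k i (r s : ℝ), w k i / r * s = w k i * (s / r) := fun k i r s => by ring
  simp only [hw]
  exact this

theorem zero_mem_shallow (σ : ℝ → ℝ) (M d : ℕ) : (fun _ => 0) ∈ shallow σ M d :=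
  ⟨fun _ => 0, fun _ => 0, fun _ _ => 0, by simp⟩

theorem abs_le_one_of_mem_smoothClass {m : ℕ} {h : (Fin 2 → ℝ) → ℝ} (hh : h ∈ smoothClass m 2)
    {u v : ℝ} (hu : |u| ≤ 1) (hv : |v| ≤ 1) : |h ![u, v]| ≤ 1 := by
  have h1 := abs_le_supNorm hh.1.continuousOn (mem_cube_two (abs_le.mp hu) (abs_le.mp hv))
  have h2 := supNorm_add_sum_le_one hh
  have h3 : 0 ≤ ∑ j ∈ Finset.Icc 1 m, (supNorm ((partialDeriv 0)^[j] h) +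
      supNorm ((partialDeriv 1)^[j] h)) :=
    Finset.sum_nonneg fun j _ => add_nonneg (supNorm_nonneg _) (supNorm_nonneg _)
  linarith

/-! ### Propagation of errors along the tree -/

namespace BinTree

/-- The trivial approximation: networks without units have error at most one. -/
theorem exists_composition_dist_le_one {ι : Type} (σ : ℝ → ℝ) (M m : ℕ) (t : BinTree ι)
    (F : (ι → ℝ) → ℝ) (hF : F ∈ t.compositions (smoothClass m 2)) :
    ∃ P ∈ t.compositions (shallow σ M 2), ∀ x : ι → ℝ, (∀ i, x i ∈ Set.Icc (-1 : ℝ) 1) →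
      |F x| ≤ 1 ∧ |F x - P x| ≤ 1 := by
  induction t generalizing F with
  | leaf i =>
    obtain rfl : F = fun x => x i := hF
    exact ⟨_, rfl, fun x hx => ⟨abs_le.mpr (hx i), by simp⟩⟩
  | node l r ihl ihr =>
    obtain ⟨h, hh, u, hu, v, hv, rfl⟩ := hF
    obtain ⟨Pu, hPu, hu⟩ := ihl u hu
    obtain ⟨Pv, hPv, hv⟩ := ihr v hv
    refine ⟨_, ⟨_, zero_mem_shallow σ M 2, Pu, hPu, Pv, hPv, rfl⟩, fun x hx => ?_⟩
    have := abs_le_one_of_mem_smoothClass hh (hu x hx).1 (hv x hx).1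
    exact ⟨this, by simpa using this⟩

/-- The induction along the tree. The error at a vertex is bounded by `ε (1 - δ)`, where `δ`
bounds the range of the constituent function there; this keeps errors from accumulating. -/
theorem exists_composition_near {ι : Type} {σ : ℝ → ℝ} {M m : ℕ} (hm : 1 ≤ m) {ε : ℝ} (hε : 0 < ε)
    (hε1 : ε ≤ 1)
    (happ : ∀ h ∈ smoothClass m 2, ∀ ρ ∈ Set.Icc (0 : ℝ) 1, ∀ τ ∈ Set.Icc (0 : ℝ) 1,
      ∃ P ∈ shallow σ M 2, ∀ x y : ℝ, |x| ≤ ρ → |y| ≤ τ →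
        |h ![x, y] - P ![x, y]| ≤ ε / 3 * ∑ j ∈ Finset.Icc 1 m,
          (ρ ^ j * supNorm ((partialDeriv 0)^[j] h) + τ ^ j * supNorm ((partialDeriv 1)^[j] h)))
    (t : BinTree ι) (F : (ι → ℝ) → ℝ) (hF : F ∈ t.compositions (smoothClass m 2)) :
    ∃ P ∈ t.compositions (shallow σ M 2), ∃ δ ∈ Set.Icc (0 : ℝ) 1,
      ∀ x : ι → ℝ, (∀ i, x i ∈ Set.Icc (-1 : ℝ) 1) →
        |F x| ≤ δ ∧ |F x - P x| ≤ ε * (1 - δ) ∧ |P x| ≤ min 1 (3 * δ) := by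
  induction t generalizing F with
  | leaf i =>
    obtain rfl : F = fun x => x i := hF
    refine ⟨_, rfl, 1, by simp, fun x hx => ?_⟩
    have := abs_le.mpr (hx i)
    refine ⟨this, by simp, le_min this (by linarith)⟩
  | node l r ihl ihr =>
    obtain ⟨h, hh, u, hu, v, hv, rfl⟩ := hF
    obtain ⟨Pu, hPu, δu, hδu, hu⟩ := ihl u hu
    obtain ⟨Pv, hPv, δv, hδv, hv⟩ := ihr v hv
    set A : ℕ → ℝ := fun j => supNorm ((partialDeriv 0)^[j] h) with hA
    set B : ℕ → ℝ := fun j => supNorm ((partialDeriv 1)^[j] h) with hB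
    have hA0 : ∀ j, 0 ≤ A j := fun j => supNorm_nonneg _
    have hB0 : ∀ j, 0 ≤ B j := fun j => supNorm_nonneg _
    have hsum : supNorm h + ∑ j ∈ Finset.Icc 1 m, (A j + B j) ≤ 1 := supNorm_add_sum_le_one hh
    have hsum0 : 0 ≤ ∑ j ∈ Finset.Icc 1 m, (A j + B j) :=
      Finset.sum_nonneg fun j _ => add_nonneg (hA0 j) (hB0 j)
    have hδ0 : 0 ≤ supNorm h := supNorm_nonneg h
    have hFle : ∀ x : ι → ℝ, (∀ i, x i ∈ Set.Icc (-1 : ℝ) 1) → |h ![u x, v x]| ≤ supNorm h :=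
      fun x hx => abs_le_supNorm hh.1.continuousOn (mem_cube_two
        (abs_le.mp ((hu x hx).1.trans hδu.2)) (abs_le.mp ((hv x hx).1.trans hδv.2)))
    rcases le_or_gt (supNorm h) (ε / 2) with hsmall | hlarge
    -- If the range is this small, the zero network suffices: `‖h‖ ≤ ε / 2 ≤ ε * (1 - ‖h‖)`, as `ε ≤
    -- 1`. This also keeps the output below `3 * δ`.
    · refine ⟨_, ⟨_, zero_mem_shallow σ M 2, Pu, hPu, Pv, hPv, rfl⟩, supNorm h,
        ⟨hδ0, by linarith⟩, fun x hx => ⟨hFle x hx, ?_, ?_⟩⟩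
      · simp only [sub_zero]
        refine (hFle x hx).trans ?_
        nlinarith
      · simp only [abs_zero]
        exact le_min zero_le_one (by linarith)
    · have hρ : ∀ δ ∈ Set.Icc (0 : ℝ) 1, min 1 (3 * δ) ∈ Set.Icc (0 : ℝ) 1 := fun δ hδ =>
        ⟨le_min zero_le_one (by linarith [hδ.1]), min_le_left _ _⟩
      obtain ⟨Q, hQ, hQh⟩ := happ h hh _ (hρ δu hδu) _ (hρ δv hδv)
      refine ⟨_, ⟨Q, hQ, Pu, hPu, Pv, hPv, rfl⟩, supNorm h, ⟨hδ0, by linarith⟩, fun x hx => ?_⟩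
      obtain ⟨u1, u2, u3⟩ := hu x hx
      obtain ⟨v1, v2, v3⟩ := hv x hx
      have hlip := abs_sub_le_of_mem_smoothClass hm hh
        (abs_le.mp (u1.trans hδu.2)) (abs_le.mp (v1.trans hδv.2))
        (abs_le.mp (u3.trans (min_le_left _ _))) (abs_le.mp (v3.trans (min_le_left _ _)))
      have hq := hQh (Pu x) (Pv x) u3 v3
      have herr : |h ![u x, v x] - Q ![Pu x, Pv x]| ≤ ε * (1 - supNorm h) := by
        have h1 : 1 ∈ Finset.Icc 1 m := Finset.mem_Icc.mpr ⟨le_rfl, hm⟩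
        -- The factor `ε / 3` in the local error cancels the `3` in the radius, leaving just what
        -- the inherited first-order error lacks.
        have hterm : ∀ δ ∈ Set.Icc (0 : ℝ) 1, ∀ c, 0 ≤ c → ε / 3 * (min 1 (3 * δ) * c) ≤
            ε * δ * c := by
          intro δ hδ c hc
          have := mul_le_mul_of_nonneg_right (min_le_right 1 (3 * δ)) hc
          have := mul_le_mul_of_nonneg_left this (by positivity : 0 ≤ ε / 3)
          linarith
        have hrest : ∑ j ∈ (Finset.Icc 1 m).erase 1,
            (min 1 (3 * δu) ^ j * A j + min 1 (3 * δv) ^ j * B j) ≤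
            ∑ j ∈ (Finset.Icc 1 m).erase 1, (A j + B j) :=
          Finset.sum_le_sum fun j _ => add_le_add
            (mul_le_of_le_one_left (hA0 j) (pow_le_one₀ (hρ δu hδu).1 (hρ δu hδu).2))
            (mul_le_of_le_one_left (hB0 j) (pow_le_one₀ (hρ δv hδv).1 (hρ δv hδv).2))
        have hrest0 : 0 ≤ ∑ j ∈ (Finset.Icc 1 m).erase 1, (A j + B j) :=
          Finset.sum_nonneg fun j _ => add_nonneg (hA0 j) (hB0 j)
        have hq' : |h ![Pu x, Pv x] - Q ![Pu x, Pv x]| ≤ ε / 3 * ∑ j ∈ Finset.Icc 1 m,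
          (min 1 (3 * δu) ^ j * A j + min 1 (3 * δv) ^ j * B j) := hq
        have hlip' : |h ![u x, v x] - h ![Pu x, Pv x]| ≤
          A 1 * |u x - Pu x| + B 1 * |v x - Pv x| := hlip
        rw [← Finset.add_sum_erase _ _ h1] at hq' hsum
        rw [pow_one, pow_one] at hq'
        have a1 := hterm δu hδu (A 1) (hA0 1)
        have b1 := hterm δv hδv (B 1) (hB0 1)
        have a2 := mul_le_mul_of_nonneg_left u2 (hA0 1)
        have b2 := mul_le_mul_of_nonneg_left v2 (hB0 1)
        have r1 := mul_le_mul_of_nonneg_left hrest (by positivity : 0 ≤ ε / 3)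
        have r2 := mul_le_mul_of_nonneg_left hsum hε.le
        have r3 : 0 ≤ ε * ∑ j ∈ (Finset.Icc 1 m).erase 1, (A j + B j) := by positivity
        refine (abs_sub_le _ (h ![Pu x, Pv x]) _).trans ?_
        linarith
      have hP : |Q ![Pu x, Pv x]| ≤ supNorm h + ε * (1 - supNorm h) := by
        have := abs_sub_abs_le_abs_sub (Q ![Pu x, Pv x]) (h ![u x, v x])
        rw [abs_sub_comm] at this
        linarith [hFle x hx]
      -- The network output is at most `δ + ε * (1 - δ)` with `δ = ‖h‖`: below `1` since `ε ≤ 1`,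
      -- and below `3 * δ` since `ε < 2 * δ` in this case.
      refine ⟨hFle x hx, herr, le_min (hP.trans ?_) (hP.trans ?_)⟩ <;> nlinarith

theorem length_leaves {ι : Type} (t : BinTree ι) : t.leaves.length = t.numInner + 1 := by
  induction t with
  | leaf i => rfl
  | node l r ihl ihr => simp only [leaves, numInner, List.length_append, ihl, ihr]; omega

theorem IsArchitecture.numInner_add_one {n : ℕ} {t : BinTree (Fin n)} (ht : t.IsArchitecture) :
    t.numInner + 1 = n := by
  rw [← length_leaves, ← List.toFinset_card_of_nodup ht.1,
    (Finset.eq_univ_iff_forall.mpr fun i => List.mem_toFinset.mpr (ht.2 i) :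
      t.leaves.toFinset = Finset.univ), Finset.card_univ, Fintype.card_fin]

end BinTree

/-! ### Choice of the degree and conclusion -/

/-- The degree is `(3 * C / ε) ^ (1 / m)` rounded up; since `ε ≤ 1`, the additive `2` in the bound
for `n + 1` is absorbed into a multiple of `ε ^ (-1 / m)`. -/
theorem exists_degree_of_accuracy {m : ℕ} (hm : 1 ≤ m) {C ε : ℝ} (hC : 0 < C) (hε : 0 < ε)
    (hε1 : ε ≤ 1) : ∃ n : ℕ, C / ((n : ℝ) + 2) ^ m ≤ ε / 3 ∧
      (((n + 1) ^ 2 : ℕ) : ℝ) ≤ ((3 * C) ^ ((m : ℝ)⁻¹) + 2) ^ 2 * ε ^ (-(2 : ℝ) / m) := by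
  have hm0 : m ≠ 0 := by omega
  refine ⟨⌈(3 * C / ε) ^ ((m : ℝ)⁻¹)⌉₊, ?_, ?_⟩
  · have h1 : (3 * C / ε) ^ ((m : ℝ)⁻¹) ≤ (⌈(3 * C / ε) ^ ((m : ℝ)⁻¹)⌉₊ : ℝ) + 2 :=
      (Nat.le_ceil _).trans (by linarith)
    have h2 := pow_le_pow_left₀ (by positivity) h1 m
    rw [Real.rpow_inv_natCast_pow (by positivity) hm0, div_le_iff₀ hε] at h2
    rw [div_le_iff₀ (by positivity)]
    linarith
  · have h1 : (⌈(3 * C / ε) ^ ((m : ℝ)⁻¹)⌉₊ : ℝ) ≤ (3 * C / ε) ^ ((m : ℝ)⁻¹) + 1 :=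
      (Nat.ceil_lt_add_one (by positivity)).le
    have hE : 1 ≤ ε ^ (-((m : ℝ)⁻¹)) :=
      Real.one_le_rpow_of_pos_of_le_one_of_nonpos hε hε1 (by simp)
    have h2 : (3 * C / ε) ^ ((m : ℝ)⁻¹) = (3 * C) ^ ((m : ℝ)⁻¹) * ε ^ (-((m : ℝ)⁻¹)) := by
      rw [Real.div_rpow (by positivity) hε.le, Real.rpow_neg hε.le, div_eq_mul_inv]
    have h3 : ε ^ (-(2 : ℝ) / m) = (ε ^ (-((m : ℝ)⁻¹))) ^ 2 := by
      rw [← Real.rpow_natCast, ← Real.rpow_mul hε.le]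
      congr 1
      push_cast
      ring
    rw [h3, ← mul_pow]
    push_cast
    refine pow_le_pow_left₀ (by positivity) ?_ 2
    have h4 := h1.trans_eq (congrArg (· + 1) h2)
    rw [add_mul]
    linarith

end DeepNet

end

theorem theorem2 (m : ℕ) (hm : 1 ≤ m) (σ : ℝ → ℝ) (hσ : ContDiff ℝ ∞ σ)
    (hpoly : ¬ ∃ p : Polynomial ℝ, ∀ x, σ x = p.eval x) :
    ∃ C : ℝ, 0 < C ∧
      ∀ (n : ℕ) (t : DeepNet.BinTree (Fin n)), t.IsArchitecture →
        ∀ ε : ℝ, 0 < ε →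
          ∃ N : ℕ, (N : ℝ) ≤ C * (((n : ℝ) - 1) * ε ^ (-(2 : ℝ) / (m : ℝ))) ∧
            ∀ f ∈ DeepNet.compositionalClass t m,
              ∃ P ∈ DeepNet.deep σ t N, ∀ x ∈ DeepNet.cube n, |f x - P x| ≤ ε := by
  obtain ⟨C, hC, hnet⟩ := DeepNet.exists_shallow_near_on_rectangle hm hσ hpoly
  refine ⟨((3 * C) ^ ((m : ℝ)⁻¹) + 2) ^ 2, by positivity, fun n t ht ε hε => ?_⟩
  have hn : (n : ℝ) - 1 = t.numInner := by
    rw [sub_eq_iff_eq_add]; exact_mod_cast ht.numInner_add_one.symm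
  rw [hn]
  rcases le_or_gt ε 1 with hε1 | hε1
  · obtain ⟨k, hk, hM⟩ := DeepNet.exists_degree_of_accuracy hm hC hε hε1
    refine ⟨t.numInner * (k + 1) ^ 2, ?_, fun f hf => ?_⟩
    · rw [Nat.cast_mul, mul_left_comm]
      exact mul_le_mul_of_nonneg_left hM (Nat.cast_nonneg _)
    · obtain ⟨F, hF, hfF⟩ := hf
      obtain ⟨P, hP, δ, hδ, h⟩ := DeepNet.BinTree.exists_composition_near
        (M := (k + 1) ^ 2) hm hε hε1
        (fun h hh ρ hρ τ hτ => by
          obtain ⟨P, hP, hPh⟩ := hnet k h hh ρ hρ τ hτ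
          refine ⟨P, hP, fun x y hx hy => (hPh x y hx hy).trans
            (mul_le_mul_of_nonneg_right hk (Finset.sum_nonneg fun j _ => ?_))⟩
          exact add_nonneg (mul_nonneg (pow_nonneg hρ.1 j) (DeepNet.supNorm_nonneg _))
            (mul_nonneg (pow_nonneg hτ.1 j) (DeepNet.supNorm_nonneg _))) t F hF
      refine ⟨P, ⟨_, rfl, hP⟩, fun x hx => ?_⟩
      rw [hfF hx]
      exact (h x hx).2.1.trans (mul_le_of_le_one_right hε.le (by linarith [hδ.1]))
  -- For `ε > 1` the allowed `N` may be below one, so networks without units are used; their error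
  -- is at most `1`.
  · refine ⟨0, by rw [Nat.cast_zero]; positivity, fun f hf => ?_⟩
    obtain ⟨F, hF, hfF⟩ := hf
    obtain ⟨P, hP, h⟩ := DeepNet.BinTree.exists_composition_dist_le_one σ 0 m t F hF
    refine ⟨P, ⟨0, rfl, hP⟩, fun x hx => ?_⟩
    rw [hfF hx]
    exact (h x hx).2.trans hε1.le
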